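/- Let $\mathcal H$ be a separable infinite-dimensional complex Hilbert space and let $a,b\in\mathcal B(\mathcal H)$ be normal operators, with spectral measures $E^a$ and $E^b$ (the projection-valued Borel measures on $\mathbb C$ with $a=\int z\,dE^a(z)$ and $b=\int z\,dE^b(z)$). Let $p_a$ denote the orthogonal projection onto the closure of the range of $a$, and let $$\mathcal O_a=\{vav^*\mid v\in\mathcal B(\mathcal H),\ v^*v=p_a\}$$ be the groupoid orbit of $a$. Two orthogonal projections $p,q\in\mathcal B(\mathcal H)$ are called Murray--von Neumann equivalent, $p\sim q$, if there is $v\in\mathcal B(\mathcal H)$ with $v^*v=p$ and $vv^*=q$. Then the following conditions are equivalent: (i) $b$ belongs to the closure of $\mathcal O_a$ in the operator norm topology of $\mathcal B(\mathcal H)$. (ii) $\operatorname{spec}(a)\cup\{0\}=\operatorname{spec}(b)\cup\{0\}$, and $E^a(\Delta)\sim E^b(\Delta)$ for every open subset $\Delta\subseteq\mathbb C\setminus\{0\}$. -/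

import Mathlib

open MeasureTheory Filter Topology
open scoped InnerProductSpace CompactlySupported

noncomputable section

namespace NormalOperator

universe u

variable {H : Type u} [NormedAddCommGroup H] [InnerProductSpace ℂ H] [CompleteSpace H]

/-! ### The spectral measure of a bounded normal operator

For every vector `x`, the functional `f ↦ ⟪x, f(a) x⟫` on the continuous functions on the compact
set `spec(a)` is positive, hence it is integration against a finite Borel measure `μₓ`
(Riesz–Markov–Kakutani).  For a Borel set `Δ`, the spectral projection `E(Δ)` is the unique bounded
operator with `⟪x, E(Δ) x⟫ = μₓ(Δ)` for all `x`. -/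

/-- A real function on the spectrum, regarded as a complex-valued continuous function. -/
def toComplexFun (a : H →L[ℂ] H) (f : C_c(spectrum ℂ a, ℝ)) : C(spectrum ℂ a, ℂ) :=
  ⟨fun z => (f z : ℂ), by fun_prop⟩

/-- The positive functional `f ↦ ⟪x, f(a) x⟫` on the real continuous functions on `spec(a)`, where
`f(a)` is given by the continuous functional calculus. -/
def spectralFunctional (a : H →L[ℂ] H) [ha : IsStarNormal a] (x : H) :
    C_c(spectrum ℂ a, ℝ) →ₚ[ℝ] ℝ :=
  PositiveLinearMap.mk₀
    { toFun := fun f => (⟪x, cfcHom ha (toComplexFun a f) x⟫_ℂ).re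
      map_add' := by
        intro f g
        have h : toComplexFun a (f + g) = toComplexFun a f + toComplexFun a g := by
          ext z; simp [toComplexFun]
        rw [h, map_add]
        simp
      map_smul' := by
        intro r f
        have h : toComplexFun a (r • f) = (r : ℂ) • toComplexFun a f := by
          ext z; simp [toComplexFun]
        rw [h, map_smul]
        simp }
    (by
      intro f hf
      open scoped ComplexOrder in
      have h0 : 0 ≤ toComplexFun a f := by
        intro z
        have : 0 ≤ f z := hf z
        simpa [toComplexFun] using this
      have h1 : 0 ≤ cfcHom ha (toComplexFun a f) := by
        open scoped ComplexOrder in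
        exact (cfcHom_nonneg_iff (R := ℂ) ha).mpr h0
      open scoped ComplexOrder in
      have h2 := ((ContinuousLinearMap.nonneg_iff_isPositive _).mp h1).inner_nonneg_right x
      open scoped ComplexOrder in
      exact (Complex.le_def.mp h2).1)

/-- The scalar spectral measure `μₓ` of `a` at the vector `x`, as a Borel measure on `ℂ`. -/
def scalarSpectralMeasure (a : H →L[ℂ] H) [IsStarNormal a] (x : H) : Measure ℂ :=
  (RealRMK.rieszMeasure (spectralFunctional a x)).map Subtype.val

instance (a : H →L[ℂ] H) [IsStarNormal a] (x : H) :
    IsFiniteMeasure (scalarSpectralMeasure a x) := by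
  have : IsFiniteMeasure (RealRMK.rieszMeasure (spectralFunctional a x)) := by
    infer_instance
  unfold scalarSpectralMeasure
  infer_instance

/-- `∫ f dμₓ = ⟪x, f(a) x⟫` for real continuous functions `f`. -/
theorem integral_scalarSpectralMeasure (a : H →L[ℂ] H) [IsStarNormal a] (x : H) {f : ℂ → ℝ}
    (hf : Continuous f) :
    ((∫ z, f z ∂(scalarSpectralMeasure a x) : ℝ) : ℂ) =
      ⟪x, cfc (fun z => (f z : ℂ)) a x⟫_ℂ := by
  have ha : IsStarNormal a := inferInstance
  let g : C_c(spectrum ℂ a, ℝ) :=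
    CompactlySupportedContinuousMap.continuousMapEquiv ⟨fun z => f z, by fun_prop⟩
  have h1 : ∫ z, f z ∂(scalarSpectralMeasure a x) = spectralFunctional a x g := by
    rw [← RealRMK.integral_rieszMeasure, scalarSpectralMeasure,
      integral_map measurable_subtype_coe.aemeasurable hf.aestronglyMeasurable]
    rfl
  have h2 : cfc (fun z => (f z : ℂ)) a = cfcHom ha (toComplexFun a g) := by
    rw [cfc_apply (fun z => (f z : ℂ)) a ha (by fun_prop)]
    rfl
  have h3 : IsSelfAdjoint (cfc (fun z => (f z : ℂ)) a) := by
    rw [IsSelfAdjoint, ← cfc_star]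
    simp
  have h4 : (⟪x, cfc (fun z => (f z : ℂ)) a x⟫_ℂ).im = 0 := by
    have h5 := h3.isSymmetric x x
    have h6 := congrArg Complex.im (inner_conj_symm x (cfc (fun z => (f z : ℂ)) a x))
    simp only [ContinuousLinearMap.coe_coe] at h5
    rw [h5] at h6
    simp only [Complex.conj_im] at h6
    linarith
  rw [h1]
  apply Complex.ext
  · rw [h2]; rfl
  · rw [h4]; simp

/-- A weak limit (along the diagonal) of bounded operators with real limits is again given by a
bounded operator. -/
theorem exists_clm_of_tendsto (T : ℕ → H →L[ℂ] H) (q : H → ℝ)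
    (hT : ∀ x, Tendsto (fun n => ⟪x, T n x⟫_ℂ) atTop (𝓝 (q x : ℂ))) :
    ∃ S : H →L[ℂ] H, ∀ x, ⟪x, S x⟫_ℂ = (q x : ℂ) := by
  have conv : ∀ x y, ∃ l, Tendsto (fun n => ⟪x, T n y⟫_ℂ) atTop (𝓝 l) := by
    intro x y
    have key : ∀ n, ⟪x, T n y⟫_ℂ = (⟪x + y, T n (x + y)⟫_ℂ - ⟪x - y, T n (x - y)⟫_ℂ
        - Complex.I * ⟪x + Complex.I • y, T n (x + Complex.I • y)⟫_ℂ
        + Complex.I * ⟪x - Complex.I • y, T n (x - Complex.I • y)⟫_ℂ) / 4 := by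
      intro n
      simp only [map_add, map_sub, map_smul, inner_add_left, inner_add_right, inner_sub_left,
        inner_sub_right, inner_smul_left, inner_smul_right, Complex.conj_I]
      ring_nf
      simp only [Complex.I_sq]
      ring
    simp_rw [key]
    exact ⟨_, ((((hT _).sub (hT _)).sub ((hT _).const_mul _)).add
      ((hT _).const_mul _)).div_const _⟩
  choose L hL using conv
  let Φ : H → StrongDual ℂ H := fun x =>
    continuousLinearMapOfTendsto (fun n => (innerSL ℂ x).comp (T n))
      (f := L x) (tendsto_pi_nhds.mpr fun y => hL x y)
  have hΦ : ∀ x y, ⟪(InnerProductSpace.toDual ℂ H).symm (Φ x), y⟫_ℂ = L x y := by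
    intro x y
    rw [InnerProductSpace.toDual_symm_apply]
    rfl
  have hLadd : ∀ x x' y, L (x + x') y = L x y + L x' y := by
    intro x x' y
    refine tendsto_nhds_unique (hL _ _) ?_
    simp_rw [inner_add_left]
    exact (hL _ _).add (hL _ _)
  have hLsmul : ∀ (c : ℂ) x y, L (c • x) y = (starRingEnd ℂ) c * L x y := by
    intro c x y
    refine tendsto_nhds_unique (hL _ _) ?_
    simp_rw [inner_smul_left]
    exact (hL _ _).const_mul _
  have hLq : ∀ x, L x x = (q x : ℂ) := fun x => tendsto_nhds_unique (hL x x) (hT x)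
  let S : H →ₗ[ℂ] H :=
    { toFun := fun x => (InnerProductSpace.toDual ℂ H).symm (Φ x)
      map_add' := by
        intro x x'
        refine ext_inner_right ℂ fun y => ?_
        rw [inner_add_left, hΦ, hΦ, hΦ, hLadd]
      map_smul' := by
        intro c x
        refine ext_inner_right ℂ fun y => ?_
        rw [RingHom.id_apply, inner_smul_left, hΦ, hΦ, hLsmul] }
  have hS : ∀ x, ⟪S x, x⟫_ℂ = (q x : ℂ) := fun x => (hΦ x x).trans (hLq x)
  have hsym : S.IsSymmetric := by
    rw [LinearMap.isSymmetric_iff_inner_map_self_real]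
    intro v
    rw [hS, Complex.conj_ofReal]
  refine ⟨hsym.toSelfAdjoint, fun x => ?_⟩
  rw [← hS x]
  exact (hsym x x).symm

/-- Continuous functions decreasing to the indicator of a closed set. -/
theorem exists_approx_closed {F : Set ℂ} (hF : IsClosed F) :
    ∃ f : ℕ → ℂ → ℝ, (∀ n, Continuous (f n)) ∧ (∀ n z, ‖f n z‖ ≤ 1) ∧
      ∀ z, Tendsto (fun n => f n z) atTop (𝓝 (F.indicator 1 z)) := by
  refine ⟨fun n z => (hF.apprSeq n z : ℝ), fun n => ?_, fun n z => ?_, fun z => ?_⟩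
  · exact NNReal.continuous_coe.comp (hF.apprSeq n).continuous
  · have := HasOuterApproxClosed.apprSeq_apply_le_one hF n z
    simpa using this
  · have h := tendsto_pi_nhds.mp (HasOuterApproxClosed.tendsto_apprSeq hF) z
    have h' := (NNReal.continuous_coe.tendsto _).comp h
    have e : F.indicator (1 : ℂ → ℝ) z = ((F.indicator (fun _ => (1 : NNReal)) z : NNReal) : ℝ) := by
      by_cases hz : z ∈ F <;> simp [hz]
    rw [e]
    exact h'

theorem tendsto_integral_approx {F : Set ℂ} (μ : Measure ℂ) [IsFiniteMeasure μ]
    {f : ℕ → ℂ → ℝ} (hf : ∀ n, Continuous (f n)) (hb : ∀ n z, ‖f n z‖ ≤ 1)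
    (ht : ∀ z, Tendsto (fun n => f n z) atTop (𝓝 (F.indicator 1 z))) {g : ℂ → ℝ}
    (hg : Measurable g) (hgb : ∀ z, ‖g z‖ ≤ 1) :
    Tendsto (fun n => ∫ z, f n z * g z ∂μ) atTop (𝓝 (∫ z, F.indicator 1 z * g z ∂μ)) := by
  refine tendsto_integral_of_dominated_convergence (fun _ => (1 : ℝ)) (fun n => ?_)
    (integrable_const _) (fun n => ?_) ?_
  · exact ((hf n).measurable.mul hg).aestronglyMeasurable
  · refine Eventually.of_forall fun z => ?_
    rw [norm_mul]
    exact mul_le_one₀ (hb n z) (norm_nonneg _) (hgb z)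
  · exact Eventually.of_forall fun z => (ht z).mul_const _

theorem scalarSpectralMeasure_univ (a : H →L[ℂ] H) [IsStarNormal a] (x : H) :
    (((scalarSpectralMeasure a x).real Set.univ : ℝ) : ℂ) = ⟪x, x⟫_ℂ := by
  have h := integral_scalarSpectralMeasure a x (f := fun _ => 1) continuous_const
  simp only [Complex.ofReal_one, integral_const, smul_eq_mul, mul_one] at h
  rw [h]
  have h1 : cfc (fun _ : ℂ => (1 : ℂ)) a = 1 := cfc_const_one ℂ a
  rw [h1]
  rfl

/-- Existence of the spectral projections. -/
theorem exists_spectralProjection (a : H →L[ℂ] H) [IsStarNormal a] {Δ : Set ℂ}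
    (hΔ : MeasurableSet Δ) :
    ∃ T : H →L[ℂ] H, ∀ x, ⟪x, T x⟫_ℂ = (((scalarSpectralMeasure a x).real Δ : ℝ) : ℂ) := by
  induction Δ, hΔ using MeasurableSpace.induction_on_inter
    (borel_eq_generateFrom_isClosed (α := ℂ) ▸ BorelSpace.measurable_eq (α := ℂ))
    isPiSystem_isClosed with
  | empty => exact ⟨0, fun x => by simp⟩
  | basic F hF =>
    have hF : IsClosed F := hF
    obtain ⟨f, hf, hb, ht⟩ := exists_approx_closed hF
    refine exists_clm_of_tendsto (fun n => cfc (fun z => (f n z : ℂ)) a) _ fun x => ?_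
    have h := tendsto_integral_approx (scalarSpectralMeasure a x) hf hb ht
      (g := fun _ => 1) measurable_const (by simp)
    simp only [mul_one] at h
    rw [integral_indicator_one hF.measurableSet] at h
    simp_rw [← integral_scalarSpectralMeasure a x (hf _)]
    exact (Complex.continuous_ofReal.tendsto _).comp h
  | compl Δ hΔ ih =>
    obtain ⟨T, hT⟩ := ih
    refine ⟨1 - T, fun x => ?_⟩
    rw [measureReal_compl hΔ, Complex.ofReal_sub, scalarSpectralMeasure_univ, ← hT]
    simp
  | iUnion f hd hm ih =>
    choose T hT using ih
    refine exists_clm_of_tendsto (fun n => ∑ i ∈ Finset.range n, T i) _ fun x => ?_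
    have h : HasSum (fun i => (scalarSpectralMeasure a x).real (f i))
        ((scalarSpectralMeasure a x).real (⋃ i, f i)) := by
      have h0 := measure_iUnion (μ := scalarSpectralMeasure a x) hd hm
      have h1 : ∑' i, scalarSpectralMeasure a x (f i) ≠ ⊤ := h0 ▸ measure_ne_top _ _
      have h2 := (ENNReal.summable_toReal h1).hasSum
      rwa [← ENNReal.tsum_toReal_eq (fun i => ENNReal.ne_top_of_tsum_ne_top h1 i), ← h0] at h2
    have h2 := (Complex.continuous_ofReal.tendsto _).comp h.tendsto_sum_nat
    refine h2.congr fun n => ?_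
    simp [hT]

/-- The spectral measure `E^a` of the normal operator `a`: for a Borel set `Δ ⊆ ℂ`, `E^a(Δ)` is the
unique bounded operator with `⟪x, E^a(Δ) x⟫ = μₓ(Δ)` for all `x`. -/
def spectralMeasure (a : H →L[ℂ] H) [IsStarNormal a] (Δ : Set ℂ) : H →L[ℂ] H :=
  open Classical in
  if h : MeasurableSet Δ then (exists_spectralProjection a h).choose else 0

/-! The next facts say that `E^a` is a projection-valued measure with `a = ∫ z dE^a(z)`. -/

theorem inner_spectralMeasure (a : H →L[ℂ] H) [IsStarNormal a] {Δ : Set ℂ}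
    (hΔ : MeasurableSet Δ) (x : H) :
    ⟪x, spectralMeasure a Δ x⟫_ℂ = (((scalarSpectralMeasure a x).real Δ : ℝ) : ℂ) := by
  rw [spectralMeasure, dif_pos hΔ]
  exact (exists_spectralProjection a hΔ).choose_spec x

/-- Weak convergence along the diagonal implies weak convergence (polarization). -/
theorem tendsto_inner_of_diag {T : ℕ → H →L[ℂ] H} {S : H →L[ℂ] H}
    (hT : ∀ x, Tendsto (fun n => ⟪x, T n x⟫_ℂ) atTop (𝓝 ⟪x, S x⟫_ℂ)) (x y : H) :
    Tendsto (fun n => ⟪x, T n y⟫_ℂ) atTop (𝓝 ⟪x, S y⟫_ℂ) := by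
  have key : ∀ R : H →L[ℂ] H, ⟪x, R y⟫_ℂ = (⟪x + y, R (x + y)⟫_ℂ - ⟪x - y, R (x - y)⟫_ℂ
      - Complex.I * ⟪x + Complex.I • y, R (x + Complex.I • y)⟫_ℂ
      + Complex.I * ⟪x - Complex.I • y, R (x - Complex.I • y)⟫_ℂ) / 4 := by
    intro R
    simp only [map_add, map_sub, map_smul, inner_add_left, inner_add_right, inner_sub_left,
      inner_sub_right, inner_smul_left, inner_smul_right, Complex.conj_I]
    ring_nf
    simp only [Complex.I_sq]
    ring
  simp_rw [key]
  exact ((((hT _).sub (hT _)).sub ((hT _).const_mul _)).add ((hT _).const_mul _)).div_const _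

theorem isSelfAdjoint_spectralMeasure (a : H →L[ℂ] H) [IsStarNormal a] {Δ : Set ℂ}
    (hΔ : MeasurableSet Δ) : IsSelfAdjoint (spectralMeasure a Δ) := by
  rw [ContinuousLinearMap.isSelfAdjoint_iff_isSymmetric,
    LinearMap.isSymmetric_iff_inner_map_self_real]
  intro v
  have h : ⟪spectralMeasure a Δ v, v⟫_ℂ = (((scalarSpectralMeasure a v).real Δ : ℝ) : ℂ) := by
    rw [← inner_conj_symm, inner_spectralMeasure a hΔ, Complex.conj_ofReal]
  simp only [ContinuousLinearMap.coe_coe]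
  rw [h, Complex.conj_ofReal]

theorem ext_diag {S T : H →L[ℂ] H} (h : ∀ x, ⟪x, S x⟫_ℂ = ⟪x, T x⟫_ℂ) : S = T := by
  ext y
  refine ext_inner_left ℂ fun x => ?_
  have h1 := tendsto_inner_of_diag (T := fun _ => S) (S := T)
    (fun x => by rw [h x]; exact tendsto_const_nhds) x y
  exact tendsto_nhds_unique tendsto_const_nhds h1

theorem spectralMeasure_univ (a : H →L[ℂ] H) [IsStarNormal a] :
    spectralMeasure a Set.univ = 1 := by
  refine ext_diag fun x => ?_
  rw [inner_spectralMeasure a MeasurableSet.univ, scalarSpectralMeasure_univ]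
  rfl

theorem spectralMeasure_compl (a : H →L[ℂ] H) [IsStarNormal a] {Δ : Set ℂ}
    (hΔ : MeasurableSet Δ) : spectralMeasure a Δᶜ = 1 - spectralMeasure a Δ := by
  refine ext_diag fun x => ?_
  rw [inner_spectralMeasure a hΔ.compl, measureReal_compl hΔ, Complex.ofReal_sub,
    scalarSpectralMeasure_univ, ← inner_spectralMeasure a hΔ]
  simp

/-- Countable additivity of `Δ ↦ ⟪x, E^a(Δ) y⟫`. -/
theorem tendsto_sum_spectralMeasure (a : H →L[ℂ] H) [IsStarNormal a] {f : ℕ → Set ℂ}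
    (hd : Pairwise (Function.onFun Disjoint f)) (hm : ∀ i, MeasurableSet (f i)) (x y : H) :
    Tendsto (fun n => ∑ i ∈ Finset.range n, ⟪x, spectralMeasure a (f i) y⟫_ℂ) atTop
      (𝓝 ⟪x, spectralMeasure a (⋃ i, f i) y⟫_ℂ) := by
  have h : ∀ x, Tendsto (fun n => ⟪x, (∑ i ∈ Finset.range n, spectralMeasure a (f i)) x⟫_ℂ) atTop
      (𝓝 ⟪x, spectralMeasure a (⋃ i, f i) x⟫_ℂ) := by
    intro x
    have h : HasSum (fun i => (scalarSpectralMeasure a x).real (f i))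
        ((scalarSpectralMeasure a x).real (⋃ i, f i)) := by
      have h0 := measure_iUnion (μ := scalarSpectralMeasure a x) hd hm
      have h1 : ∑' i, scalarSpectralMeasure a x (f i) ≠ ⊤ := h0 ▸ measure_ne_top _ _
      have h2 := (ENNReal.summable_toReal h1).hasSum
      rwa [← ENNReal.tsum_toReal_eq (fun i => ENNReal.ne_top_of_tsum_ne_top h1 i), ← h0] at h2
    have h2 := (Complex.continuous_ofReal.tendsto _).comp h.tendsto_sum_nat
    rw [inner_spectralMeasure a (MeasurableSet.iUnion hm)]
    refine h2.congr fun n => ?_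
    simp [inner_spectralMeasure a (hm _)]
  refine (tendsto_inner_of_diag h x y).congr fun n => ?_
  simp

theorem spectralMeasure_inter_closed (a : H →L[ℂ] H) [IsStarNormal a] {K L : Set ℂ}
    (hK : IsClosed K) (hL : IsClosed L) :
    spectralMeasure a K * spectralMeasure a L = spectralMeasure a (K ∩ L) := by
  have lim : ∀ {F : Set ℂ} (hF : IsClosed F) {f : ℕ → ℂ → ℝ} (_ : ∀ n, Continuous (f n))
      (_ : ∀ n z, ‖f n z‖ ≤ 1) (_ : ∀ z, Tendsto (fun n => f n z) atTop (𝓝 (F.indicator 1 z)))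
      (x y : H), Tendsto (fun n => ⟪x, cfc (fun z => (f n z : ℂ)) a y⟫_ℂ) atTop
        (𝓝 ⟪x, spectralMeasure a F y⟫_ℂ) := by
    intro F hF f hf hb ht x y
    refine tendsto_inner_of_diag (fun x => ?_) x y
    have h := tendsto_integral_approx (scalarSpectralMeasure a x) hf hb ht
      (g := fun _ => 1) measurable_const (by simp)
    simp only [mul_one] at h
    rw [integral_indicator_one hF.measurableSet] at h
    rw [inner_spectralMeasure a hF.measurableSet]
    simp_rw [← integral_scalarSpectralMeasure a x (hf _)]
    exact (Complex.continuous_ofReal.tendsto _).comp h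
  obtain ⟨f, hf, hfb, hft⟩ := exists_approx_closed hK
  obtain ⟨g, hg, hgb, hgt⟩ := exists_approx_closed hL
  have hgL : ∀ z, ‖L.indicator (1 : ℂ → ℝ) z‖ ≤ 1 := by
    intro z
    by_cases hz : z ∈ L <;> simp [hz]
  refine ext_diag fun x => ?_
  have step : ∀ m, ((∫ z, f m z * L.indicator 1 z ∂(scalarSpectralMeasure a x) : ℝ) : ℂ) =
      ⟪x, cfc (fun z => (f m z : ℂ)) a (spectralMeasure a L x)⟫_ℂ := by
    intro m
    have hsa : IsSelfAdjoint (cfc (fun z => (f m z : ℂ)) a) := by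
      rw [IsSelfAdjoint, ← cfc_star]
      simp
    have h1 := tendsto_integral_approx (scalarSpectralMeasure a x) hg hgb hgt
      (g := f m) (hf m).measurable (hfb m)
    have h2 := (Complex.continuous_ofReal.tendsto _).comp h1
    have h3 := lim hL hg hgb hgt (cfc (fun z => (f m z : ℂ)) a x) x
    rw [show ⟪x, cfc (fun z => (f m z : ℂ)) a (spectralMeasure a L x)⟫_ℂ =
      ⟪cfc (fun z => (f m z : ℂ)) a x, spectralMeasure a L x⟫_ℂ from
      (hsa.isSymmetric x _).symm]
    simp_rw [mul_comm (f m _)]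
    refine tendsto_nhds_unique h2 (h3.congr fun n => ?_)
    rw [show ⟪cfc (fun z => (f m z : ℂ)) a x, cfc (fun z => (g n z : ℂ)) a x⟫_ℂ =
      ⟪x, (cfc (fun z => (f m z : ℂ)) a * cfc (fun z => (g n z : ℂ)) a) x⟫_ℂ from
      hsa.isSymmetric x _]
    have hfm := hf m
    have hgn := hg n
    rw [← cfc_mul (fun z => (f m z : ℂ)) (fun z => (g n z : ℂ)) a (by fun_prop) (by fun_prop)]
    simp only [Function.comp_apply]
    rw [integral_scalarSpectralMeasure a x (f := fun z => g n z * f m z) (hgn.mul hfm)]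
    simp only [Complex.ofReal_mul, mul_comm]
  have h4 := lim hK hf hfb hft x (spectralMeasure a L x)
  simp_rw [← step] at h4
  have h5 := (Complex.continuous_ofReal.tendsto _).comp
    (tendsto_integral_approx (scalarSpectralMeasure a x) hf hfb hft
      (g := L.indicator 1) (measurable_one.indicator hL.measurableSet) hgL)
  have h6 := tendsto_nhds_unique h4 h5
  rw [inner_spectralMeasure a (hK.inter hL).measurableSet,
    ← integral_indicator_one (hK.inter hL).measurableSet]
  rw [mul_apply_eq_comp, h6]
  congr 2
  ext z
  by_cases h1 : z ∈ K <;> by_cases h2 : z ∈ L <;> simp [h1, h2]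

theorem spectralMeasure_inter_of_closed (a : H →L[ℂ] H) [IsStarNormal a] {A : Set ℂ}
    (hA : MeasurableSet A)
    (h : ∀ F, IsClosed F →
      spectralMeasure a A * spectralMeasure a F = spectralMeasure a (A ∩ F))
    {Δ : Set ℂ} (hΔ : MeasurableSet Δ) :
    spectralMeasure a A * spectralMeasure a Δ = spectralMeasure a (A ∩ Δ) := by
  have hsa := isSelfAdjoint_spectralMeasure a hA
  have add : ∀ {f : ℕ → Set ℂ} (_ : Pairwise (Function.onFun Disjoint f))
      (_ : ∀ i, MeasurableSet (f i))
      (_ : ∀ i, spectralMeasure a A * spectralMeasure a (f i) = spectralMeasure a (A ∩ f i)),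
      spectralMeasure a A * spectralMeasure a (⋃ i, f i) =
        spectralMeasure a (A ∩ ⋃ i, f i) := by
    intro f hd hm ih
    ext y
    refine ext_inner_left ℂ fun x => ?_
    have h1 := tendsto_sum_spectralMeasure a hd hm (spectralMeasure a A x) y
    have hd' : Pairwise (Function.onFun Disjoint fun i => A ∩ f i) := fun i j hij =>
      (hd hij).mono Set.inter_subset_right Set.inter_subset_right
    have h2 := tendsto_sum_spectralMeasure a hd' (fun i => hA.inter (hm i)) x y
    rw [← Set.inter_iUnion] at h2
    have h3 : ∀ Γ, ⟪spectralMeasure a A x, spectralMeasure a Γ y⟫_ℂ =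
        ⟪x, (spectralMeasure a A * spectralMeasure a Γ) y⟫_ℂ := fun Γ => hsa.isSymmetric x _
    simp_rw [h3, ih] at h1
    exact tendsto_nhds_unique h1 h2
  induction Δ, hΔ using MeasurableSpace.induction_on_inter
    (borel_eq_generateFrom_isClosed (α := ℂ) ▸ BorelSpace.measurable_eq (α := ℂ))
    isPiSystem_isClosed with
  | empty => exact h _ isClosed_empty
  | basic F hF => exact h F hF
  | compl Δ hΔ ih =>
    rw [spectralMeasure_compl a hΔ, mul_sub, mul_one, ih]
    refine ext_diag fun x => ?_
    rw [sub_apply, inner_sub_right, inner_spectralMeasure a hA,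
      inner_spectralMeasure a (hA.inter hΔ), inner_spectralMeasure a (hA.inter hΔ.compl),
      ← measureReal_inter_add_sdiff (μ := scalarSpectralMeasure a x) (s := A) hΔ,
      Set.sdiff_eq_compl_inter, Set.inter_comm Δᶜ A]
    push_cast
    ring
  | iUnion f hd hm ih => exact add hd hm ih

/-- `E^a` is multiplicative. -/
theorem spectralMeasure_inter (a : H →L[ℂ] H) [IsStarNormal a] {Δ Γ : Set ℂ}
    (hΔ : MeasurableSet Δ) (hΓ : MeasurableSet Γ) :
    spectralMeasure a Δ * spectralMeasure a Γ = spectralMeasure a (Δ ∩ Γ) := by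
  refine spectralMeasure_inter_of_closed a hΔ (fun F hF => ?_) hΓ
  have h := spectralMeasure_inter_of_closed a hF.measurableSet
    (fun K hK => spectralMeasure_inter_closed a hF hK) hΔ
  have h2 := congrArg star h
  rwa [star_mul, (isSelfAdjoint_spectralMeasure a hΔ).star_eq,
    (isSelfAdjoint_spectralMeasure a hF.measurableSet).star_eq,
    (isSelfAdjoint_spectralMeasure a (hF.measurableSet.inter hΔ)).star_eq,
    Set.inter_comm] at h2

/-- The values of `E^a` are orthogonal projections. -/
theorem isStarProjection_spectralMeasure (a : H →L[ℂ] H) [IsStarNormal a] {Δ : Set ℂ}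
    (hΔ : MeasurableSet Δ) : IsStarProjection (spectralMeasure a Δ) where
  isIdempotentElem := by
    rw [IsIdempotentElem, spectralMeasure_inter a hΔ hΔ, Set.inter_self]
  isSelfAdjoint := isSelfAdjoint_spectralMeasure a hΔ

theorem integrable_scalarSpectralMeasure (a : H →L[ℂ] H) [IsStarNormal a] (x : H)
    {E : Type*} [NormedAddCommGroup E] [SecondCountableTopologyEither ℂ E] {f : ℂ → E}
    (hf : Continuous f) : Integrable f (scalarSpectralMeasure a x) := by
  unfold scalarSpectralMeasure
  rw [integrable_map_measure hf.aestronglyMeasurable measurable_subtype_coe.aemeasurable]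
  have : IsFiniteMeasure (RealRMK.rieszMeasure (spectralFunctional a x)) := by
    infer_instance
  exact (hf.comp continuous_subtype_val).integrable_of_hasCompactSupport
    (HasCompactSupport.of_compactSpace _)

/-- `a = ∫ z dE^a(z)`. -/
theorem inner_eq_integral_spectralMeasure (a : H →L[ℂ] H) [IsStarNormal a] (x : H) :
    ⟪x, a x⟫_ℂ = ∫ z, z ∂(scalarSpectralMeasure a x) := by
  have ha : IsStarNormal a := inferInstance
  have h1 : a = cfc (fun z : ℂ => (z.re : ℂ)) a + Complex.I • cfc (fun z : ℂ => (z.im : ℂ)) a := by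
    rw [← cfc_smul Complex.I (fun z : ℂ => (z.im : ℂ)) a (by fun_prop),
      ← cfc_add a (fun z : ℂ => (z.re : ℂ)) (fun z : ℂ => Complex.I • (z.im : ℂ))
        (by fun_prop) (by fun_prop)]
    conv_lhs => rw [← cfc_id ℂ a]
    congr 1
    ext z
    simp [mul_comm Complex.I, Complex.re_add_im]
  conv_lhs => rw [h1]
  rw [add_apply, smul_apply, inner_add_right,
    inner_smul_right, ← integral_scalarSpectralMeasure a x Complex.continuous_re,
    ← integral_scalarSpectralMeasure a x Complex.continuous_im]
  have h2 := integral_re_add_im (𝕜 := ℂ) (integrable_scalarSpectralMeasure a x continuous_id)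
  rw [mul_comm]
  exact h2

/-! ### Range projections, groupoid orbits and Murray–von Neumann equivalence -/

/-- The orthogonal projection `p_a` onto the closure of the range of `a`. -/
def rangeProjection (a : H →L[ℂ] H) : H →L[ℂ] H :=
  a.range.topologicalClosure.starProjection

/-- The groupoid orbit `O_a = {v a v* | v*v = p_a}`. -/
def groupoidOrbit (a : H →L[ℂ] H) : Set (H →L[ℂ] H) :=
  {x | ∃ v : H →L[ℂ] H, star v * v = rangeProjection a ∧ x = v * a * star v}

/-- Murray–von Neumann equivalence of the projections `p` and `q` in `B(H)`. -/
def MurrayVonNeumannEquiv (p q : H →L[ℂ] H) : Prop :=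
  ∃ v : H →L[ℂ] H, star v * v = p ∧ v * star v = q

end NormalOperator

end

noncomputable section

namespace NormalOperator

universe u

variable {H : Type u} [NormedAddCommGroup H] [InnerProductSpace ℂ H] [CompleteSpace H]

/-! ### Scalar spectral measures -/

/-! From (i) to (ii), let `v n * a * star (v n)` tend to `b`. The contractions `v n` intertwine `a`
and `b`, and their adjoints, asymptotically, hence also `g(a)` and `g(b)` for continuous `g`
(Stone–Weierstrass, `tendsto_intertwine_cfc`). So `g(a) a` and `g(b) b` are norm limits of
compressions of each other. With `g` the distance to the complement of `Δ`, their range projections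
are `E^a(Δ)` and `E^b(Δ)` (`rangeProjection_cfc_mul`). Rank is lower semicontinuous, because linear
independence is an open condition, so the two ranks agree in `ℕ ∪ {∞}`, and on a separable space
rank decides equivalence. The spectra then agree off `0`, since they are read off from the
nonvanishing of the spectral projections of small balls.

From (ii) to (i), cut a punctured disc carrying both operators into finitely many small cells and
choose orthonormal bases subordinate to the cells. Equivalence of `E^a(U)` and `E^b(U)`, for `U` the
trace on the disc of a union of small balls, is exactly Hall's condition for matching the basis of
`a` injectively into that of `b` while moving cells only slightly (`exists_injective_matching`). By
symmetry and Schröder–Bernstein there is a bijective matching with the same bound. The partial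
isometry it induces carries `a` close to `b`, because both are nearly diagonal with nearly equal
eigenvalues. -/

theorem scalarSpectralMeasure_compl_spectrum (a : H →L[ℂ] H) [IsStarNormal a] (x : H) :
    scalarSpectralMeasure a x (spectrum ℂ a)ᶜ = 0 := by
  rw [scalarSpectralMeasure, Measure.map_apply measurable_subtype_coe
    (spectrum.isClosed a).measurableSet.compl]
  simp

omit [CompleteSpace H] in
theorem inner_self_eq_ofReal_norm_sq (x : H) : ⟪x, x⟫_ℂ = ((‖x‖ ^ 2 : ℝ) : ℂ) := by
  rw [inner_self_eq_norm_sq_to_K]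
  simp

theorem scalarSpectralMeasure_real_univ (a : H →L[ℂ] H) [IsStarNormal a] (x : H) :
    (scalarSpectralMeasure a x).real Set.univ = ‖x‖ ^ 2 := by
  have h := scalarSpectralMeasure_univ a x
  rw [inner_self_eq_ofReal_norm_sq] at h
  exact Complex.ofReal_injective h

theorem norm_sq_of_isStarProjection {P : H →L[ℂ] H} (hP : IsStarProjection P) (x : H) :
    ((‖P x‖ ^ 2 : ℝ) : ℂ) = ⟪x, P x⟫_ℂ := by
  have h := hP.isSelfAdjoint.isSymmetric x (P x)
  have h2 : P (P x) = P x := congrArg (fun T : H →L[ℂ] H => T x) hP.isIdempotentElem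
  simp only [ContinuousLinearMap.coe_coe] at h
  rw [h2] at h
  rw [← h, inner_self_eq_ofReal_norm_sq]

theorem norm_sq_spectralMeasure_apply (a : H →L[ℂ] H) [IsStarNormal a] {Δ : Set ℂ}
    (hΔ : MeasurableSet Δ) (x : H) :
    ‖spectralMeasure a Δ x‖ ^ 2 = (scalarSpectralMeasure a x).real Δ := by
  have h := norm_sq_of_isStarProjection (isStarProjection_spectralMeasure a hΔ) x
  rw [inner_spectralMeasure a hΔ] at h
  exact Complex.ofReal_injective h

theorem spectralMeasure_apply_eq_zero_iff (a : H →L[ℂ] H) [IsStarNormal a] {Δ : Set ℂ}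
    (hΔ : MeasurableSet Δ) (x : H) :
    spectralMeasure a Δ x = 0 ↔ scalarSpectralMeasure a x Δ = 0 := by
  rw [← norm_eq_zero, ← sq_eq_zero_iff, norm_sq_spectralMeasure_apply a hΔ,
    measureReal_eq_zero_iff]

/-- The norm of `(g(a) a)* x` in terms of the scalar spectral measure. -/
theorem norm_sq_star_cfc_mul_apply (a : H →L[ℂ] H) [IsStarNormal a] {g : ℂ → ℝ}
    (hg : Continuous g) (x : H) :
    ‖star (cfc (fun z => (g z : ℂ)) a * a) x‖ ^ 2 =
      ∫ z, (g z * ‖z‖) ^ 2 ∂(scalarSpectralMeasure a x) := by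
  have ha : IsStarNormal a := inferInstance
  have h1 : cfc (fun z => (g z : ℂ)) a * a = cfc (fun z => (g z : ℂ) * z) a := by
    rw [cfc_mul (fun z => (g z : ℂ)) (fun z => z) a (by fun_prop) (by fun_prop), cfc_id' ℂ a]
  have h2 : (cfc (fun z => (g z : ℂ)) a * a) * star (cfc (fun z => (g z : ℂ)) a * a) =
      cfc (fun z => (((g z * ‖z‖) ^ 2 : ℝ) : ℂ)) a := by
    rw [h1, ← cfc_star, ← cfc_mul _ _ a (by fun_prop) (by fun_prop)]
    congr 1
    ext z
    rw [mul_pow, ← Complex.normSq_eq_norm_sq, Complex.star_def, map_mul, Complex.conj_ofReal]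
    push_cast
    rw [← Complex.mul_conj]
    ring
  have h3 := integral_scalarSpectralMeasure a x (f := fun z => (g z * ‖z‖) ^ 2) (by fun_prop)
  rw [← h2, mul_apply_eq_comp,
    ← ContinuousLinearMap.adjoint_inner_left, ← ContinuousLinearMap.star_eq_adjoint,
    inner_self_eq_ofReal_norm_sq] at h3
  exact Complex.ofReal_injective h3.symm

/-- The closure of the range of `T` is the orthogonal complement of the kernel of `star T`, so equal
kernels force equal closed ranges. -/
theorem rangeProjection_eq_of_ker {T P : H →L[ℂ] H} (hP : IsStarProjection P)
    (h : ∀ x, star T x = 0 ↔ P x = 0) : rangeProjection T = P := by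
  have h1 : T.range.topologicalClosure = P.range.topologicalClosure := by
    have hT := (star T).orthogonal_ker
    have hP' := P.orthogonal_ker
    rw [← ContinuousLinearMap.star_eq_adjoint] at hT hP'
    rw [star_star] at hT
    rw [hP.isSelfAdjoint.star_eq] at hP'
    rw [← hT, ← hP']
    congr 1
    ext x
    exact h x
  have h2 : IsStarProjection (rangeProjection T) := isStarProjection_starProjection
  refine ContinuousLinearMap.IsStarProjection.ext h2 hP ?_
  rw [rangeProjection, Submodule.range_starProjection, h1]
  exact (ContinuousLinearMap.IsIdempotentElem.isClosed_range hP.isIdempotentElem).submodule_topologicalClosure_eq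

/-- If `Δ` is the set where `g(z) z ≠ 0`, then `E^a(Δ)` is the range projection of `g(a) a`. -/
theorem rangeProjection_cfc_mul (a : H →L[ℂ] H) [IsStarNormal a] {g : ℂ → ℝ}
    (hg : Continuous g) :
    rangeProjection (cfc (fun z => (g z : ℂ)) a * a) = spectralMeasure a {z | g z * ‖z‖ ≠ 0} := by
  have hm : MeasurableSet {z : ℂ | g z * ‖z‖ ≠ 0} :=
    (isOpen_ne.preimage (by fun_prop : Continuous fun z : ℂ => g z * ‖z‖)).measurableSet
  refine rangeProjection_eq_of_ker (isStarProjection_spectralMeasure a hm) fun x => ?_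
  rw [spectralMeasure_apply_eq_zero_iff a hm, ← norm_eq_zero, ← sq_eq_zero_iff,
    norm_sq_star_cfc_mul_apply a hg, integral_eq_zero_iff_of_nonneg (fun z => by positivity)
    (integrable_scalarSpectralMeasure a x (by fun_prop))]
  rw [Filter.EventuallyEq, ae_iff]
  simp

theorem rangeProjection_eq_spectralMeasure (a : H →L[ℂ] H) [IsStarNormal a] :
    rangeProjection a = spectralMeasure a {0}ᶜ := by
  have h := rangeProjection_cfc_mul a (g := fun _ => 1) continuous_const
  have h1 : cfc (fun _ : ℂ => (1 : ℂ)) a = 1 := cfc_const_one ℂ a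
  simp only [Complex.ofReal_one, h1, one_mul] at h
  rw [h]
  congr 1
  ext z
  simp

/-- If the projection of a ball of radius `r` vanishes, the tent function of height `r` on it is
sent to `0` by the functional calculus, and spectral mapping would put `r` in the spectrum of `0`.
Conversely, the scalar measures are carried by the spectrum. -/
theorem mem_spectrum_iff_spectralMeasure_ball_ne_zero (a : H →L[ℂ] H) [IsStarNormal a] (l : ℂ) :
    l ∈ spectrum ℂ a ↔ ∀ r > 0, spectralMeasure a (Metric.ball l r) ≠ 0 := by
  have ha : IsStarNormal a := inferInstance
  constructor
  · intro hl r hr h0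
    have h1 : ∀ x, scalarSpectralMeasure a x (Metric.ball l r) = 0 := fun x => by
      rw [← spectralMeasure_apply_eq_zero_iff a measurableSet_ball, h0]
      rfl
    have hc : Continuous fun z : ℂ => max 0 (r - dist z l) := by fun_prop
    have h2 : cfc (fun z : ℂ => ((max 0 (r - dist z l) : ℝ) : ℂ)) a = 0 := by
      refine ext_diag fun x => ?_
      rw [← integral_scalarSpectralMeasure a x hc, integral_eq_zero_of_ae]
      · simp
      · rw [Filter.EventuallyEq, ae_iff]
        refine measure_mono_null (fun z hz => ?_) (h1 x)
        by_contra hz'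
        simp only [Metric.mem_ball, not_lt] at hz'
        exact hz (max_eq_left (by linarith))
    have h3 := cfc_map_spectrum (fun z : ℂ => ((max 0 (r - dist z l) : ℝ) : ℂ)) a ha
      (by fun_prop)
    have h4 : (r : ℂ) ∈ spectrum ℂ (0 : H →L[ℂ] H) := by
      rw [← h2, h3]
      exact ⟨l, hl, by simp [hr.le]⟩
    rw [spectrum.mem_iff, sub_zero] at h4
    refine h4 ?_
    exact (IsUnit.mk0 (r : ℂ) (by exact_mod_cast hr.ne')).map (algebraMap ℂ (H →L[ℂ] H))
  · intro h
    by_contra hl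
    obtain ⟨r, hr, hb⟩ := Metric.isOpen_iff.mp (spectrum.isClosed (𝕜 := ℂ) a).isOpen_compl l hl
    refine h r hr (ContinuousLinearMap.ext fun x => ?_)
    exact (spectralMeasure_apply_eq_zero_iff a measurableSet_ball x).mpr
      (measure_mono_null hb (scalarSpectralMeasure_compl_spectrum a x))

/-! ### Orthonormal bases of ranges of projections -/

/-- `e` is an orthonormal basis of the range of the projection `P` (Parseval form). -/
structure IsRangeBasis {A : Type*} (P : H →L[ℂ] H) (e : A → H) : Prop where
  orthonormal : Orthonormal ℂ e
  hasSum : ∀ y, HasSum (fun i => ‖⟪e i, y⟫_ℂ‖ ^ 2) (‖P y‖ ^ 2)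

theorem apply_eq_self_of_norm_eq {P : H →L[ℂ] H} (hP : IsStarProjection P) {y : H}
    (h : ‖P y‖ = ‖y‖) : P y = y := by
  rw [isStarProjection_iff_eq_starProjection_range] at hP
  obtain ⟨_, hP⟩ := hP
  rw [hP] at h ⊢
  exact Submodule.starProjection_eq_self_iff.mpr
    ((P.range.mem_iff_norm_starProjection y).mpr h)

theorem norm_apply_le_of_isStarProjection {P : H →L[ℂ] H} (hP : IsStarProjection P) (y : H) :
    ‖P y‖ ≤ ‖y‖ := by
  rw [isStarProjection_iff_eq_starProjection_range] at hP
  obtain ⟨_, hP⟩ := hP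
  rw [hP]
  exact Submodule.norm_starProjection_apply_le _ y

/-- The Parseval sum at `e i` already contains the term `1`, so `P` does not shrink `e i`. -/
theorem IsRangeBasis.apply_eq_self {A : Type*} {P : H →L[ℂ] H} (hP : IsStarProjection P)
    {e : A → H} (he : IsRangeBasis P e) (i : A) : P (e i) = e i := by
  refine apply_eq_self_of_norm_eq hP (le_antisymm (norm_apply_le_of_isStarProjection hP _) ?_)
  have h := le_hasSum (he.hasSum (e i)) i fun j _ => sq_nonneg _
  rw [inner_self_eq_ofReal_norm_sq, he.orthonormal.norm_eq_one i] at h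
  rw [he.orthonormal.norm_eq_one i]
  norm_num at h
  exact h

theorem exists_isRangeBasis {P : H →L[ℂ] H} (hP : IsStarProjection P) :
    ∃ (A : Type u) (e : A → H), IsRangeBasis P e := by
  have hc : IsClosed (P.range : Set H) :=
    ContinuousLinearMap.IsIdempotentElem.isClosed_range hP.isIdempotentElem
  have : CompleteSpace P.range := hc.completeSpace_coe
  obtain ⟨w, b, -⟩ := exists_hilbertBasis ℂ P.range
  refine ⟨w, fun i => (b i : H), b.orthonormal.comp_linearIsometry P.range.subtypeₗᵢ, fun y => ?_⟩
  obtain ⟨_, hP'⟩ := isStarProjection_iff_eq_starProjection_range.mp hP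
  have hy : P y = (P.range.orthogonalProjectionOnto y : H) := by
    conv_lhs => rw [hP']
    exact Submodule.starProjection_apply _ y
  have h := lp.hasSum_norm (p := 2) (by norm_num) (b.repr (P.range.orthogonalProjectionOnto y))
  simp only [ENNReal.toReal_ofNat, Real.rpow_ofNat, b.repr.norm_map, b.repr_apply_apply] at h
  simp only [Submodule.inner_orthogonalProjectionOnto_eq_of_mem_left] at h
  rw [hy]
  exact h

omit [CompleteSpace H] in
theorem countable_of_orthonormal [TopologicalSpace.SeparableSpace H] {A : Type*} {e : A → H}
    (he : Orthonormal ℂ e) : Countable A := by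
  refine Pairwise.countable_of_isOpen_disjoint (s := fun i => Metric.ball (e i) (1 / 2))
    (fun i j hij => ?_) (fun i => Metric.isOpen_ball) fun i => ⟨e i, by simp⟩
  refine Metric.ball_disjoint_ball ?_
  have h := norm_sub_sq (𝕜 := ℂ) (e i) (e j)
  rw [he.inner_eq_zero hij, he.norm_eq_one, he.norm_eq_one] at h
  rw [dist_eq_norm]
  norm_num at h ⊢
  nlinarith [norm_nonneg (e i - e j)]

/-- A partial isometry carrying one orthonormal family to another. -/
theorem exists_partialIsometry {A : Type*} {P Q : H →L[ℂ] H} (hP : IsStarProjection P)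
    (hQ : IsStarProjection Q) {e f : A → H} (he : IsRangeBasis P e) (hf : IsRangeBasis Q f) :
    ∃ v : H →L[ℂ] H, star v * v = P ∧ v * star v = Q ∧
      ∀ i y, ⟪e i, star v y⟫_ℂ = ⟪f i, y⟫_ℂ := by
  classical
  -- Each family gives an isometry `V` from `ℓ²(A)` with `V* V = 1` and `V V*` the projection onto
  -- its closed span. The partial isometry is `V_f V_e*`.
  let V : {g : A → H} → Orthonormal ℂ g → (lp (fun _ : A => ℂ) 2 →L[ℂ] H) := fun hg =>
    hg.orthogonalFamily.linearIsometry.toContinuousLinearMap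
  have hV : ∀ {g : A → H} (hg : Orthonormal ℂ g), (V hg).adjoint ∘L V hg = 1 := fun hg =>
    (ContinuousLinearMap.norm_map_iff_adjoint_comp_self _).mp
      hg.orthogonalFamily.linearIsometry.norm_map
  have hc : ∀ {g : A → H} (hg : Orthonormal ℂ g) (i : A) (y : H),
      (V hg).adjoint y i = ⟪g i, y⟫_ℂ := by
    intro g hg i y
    have h1 : V hg (lp.single 2 i (1 : ℂ)) = g i := by
      simp [V]
    rw [← h1, ← ContinuousLinearMap.adjoint_inner_right, lp.inner_single_left]
    simp
  have hproj : ∀ {g : A → H} (hg : Orthonormal ℂ g) {R : H →L[ℂ] H} (_ : IsStarProjection R)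
      (_ : IsRangeBasis R g), V hg ∘L (V hg).adjoint = R := by
    intro g hg R hR hgR
    refine ext_diag fun y => ?_
    rw [← norm_sq_of_isStarProjection hR, ContinuousLinearMap.comp_apply,
      ← ContinuousLinearMap.adjoint_inner_left, inner_self_eq_ofReal_norm_sq]
    congr 1
    have h := lp.hasSum_norm (p := 2) (by norm_num) ((V hg).adjoint y)
    simp only [ENNReal.toReal_ofNat, Real.rpow_ofNat, hc] at h
    exact h.unique (hgR.hasSum y)
  have hs : star (V hf.orthonormal ∘L (V he.orthonormal).adjoint) =
      V he.orthonormal ∘L (V hf.orthonormal).adjoint := by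
    rw [ContinuousLinearMap.star_eq_adjoint, ContinuousLinearMap.adjoint_comp,
      ContinuousLinearMap.adjoint_adjoint]
  refine ⟨V hf.orthonormal ∘L (V he.orthonormal).adjoint, ?_, ?_, fun i y => ?_⟩
  · refine Eq.trans ?_ (hproj he.orthonormal hP he)
    rw [hs]
    ext y
    have := congrArg (fun T => T ((V he.orthonormal).adjoint y)) (hV hf.orthonormal)
    exact congrArg (V he.orthonormal) this
  · refine Eq.trans ?_ (hproj hf.orthonormal hQ hf)
    rw [hs]
    ext y
    have := congrArg (fun T => T ((V hf.orthonormal).adjoint y)) (hV he.orthonormal)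
    exact congrArg (V hf.orthonormal) this
  · rw [hs, ← hc he.orthonormal, ← hc hf.orthonormal]
    have := congrArg (fun T => T ((V hf.orthonormal).adjoint y)) (hV he.orthonormal)
    exact congrArg (fun z : lp (fun _ : A => ℂ) 2 => z i) this

theorem murrayVonNeumannEquiv_of_equiv {A B : Type*} {P Q : H →L[ℂ] H} (hP : IsStarProjection P)
    (hQ : IsStarProjection Q) {e : A → H} {f : B → H} (he : IsRangeBasis P e)
    (hf : IsRangeBasis Q f) (φ : A ≃ B) : MurrayVonNeumannEquiv P Q := by
  have hf' : IsRangeBasis Q (f ∘ φ) :=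
    ⟨hf.orthonormal.comp φ φ.injective, fun y => (φ.hasSum_iff).mpr (hf.hasSum y)⟩
  obtain ⟨v, h1, h2, -⟩ := exists_partialIsometry hP hQ he hf'
  exact ⟨v, h1, h2⟩

/-- The size of a linearly independent family in the range of `P` is at most the size of a finite
orthonormal basis. -/
theorem card_le_of_isRangeBasis {B : Type*} [Fintype B] {Q : H →L[ℂ] H}
    (hQ : IsStarProjection Q) {f : B → H} (hf : IsRangeBasis Q f) {n : ℕ} {y : Fin n → H}
    (hy : LinearIndependent ℂ y) (hQy : ∀ i, Q (y i) = y i) : n ≤ Fintype.card B := by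
  classical
  have hspan : ∀ i, y i ∈ Submodule.span ℂ (Set.range f) := by
    intro i
    -- The remainder of the Fourier expansion is in the range of `Q` and orthogonal to every `f j`,
    -- so Parseval makes it `0`.
    have h1 : Q (y i - ∑ j, ⟪f j, y i⟫_ℂ • f j) = y i - ∑ j, ⟪f j, y i⟫_ℂ • f j := by
      simp only [map_sub, map_sum, map_smul, hQy, hf.apply_eq_self hQ]
    have h2 : ∀ k, ⟪f k, y i - ∑ j, ⟪f j, y i⟫_ℂ • f j⟫_ℂ = 0 := fun k => by
      rw [inner_sub_right, hf.orthonormal.inner_right_fintype, sub_self]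
    have h3 := hf.hasSum (y i - ∑ j, ⟪f j, y i⟫_ℂ • f j)
    simp only [h2, h1, norm_zero, zero_pow two_ne_zero] at h3
    rw [sub_eq_zero.mp (norm_eq_zero.mp (pow_eq_zero_iff two_ne_zero |>.mp
      (h3.unique hasSum_zero)))]
    exact Submodule.sum_mem _ fun j _ =>
      Submodule.smul_mem _ _ (Submodule.subset_span (Set.mem_range_self j))
  have h := linearIndependent_le_span_aux' y hy (Set.range f)
    (by rintro _ ⟨i, rfl⟩; exact hspan i)
  rw [Fintype.card_fin] at h
  exact h.trans (Fintype.card_range_le f)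

/-! ### Limits of the groupoid orbit -/

/-- Asymptotic intertwining passes to the continuous functional calculus. -/
theorem tendsto_intertwine_cfc (a b : H →L[ℂ] H) [ha : IsStarNormal a] [hb : IsStarNormal b]
    {w : ℕ → H →L[ℂ] H} (hw : ∀ n, ‖w n‖ ≤ 1)
    (h1 : Tendsto (fun n => w n * a - b * w n) atTop (𝓝 0))
    (h2 : Tendsto (fun n => w n * star a - star b * w n) atTop (𝓝 0))
    {g : ℂ → ℂ} (hg : Continuous g) :
    Tendsto (fun n => w n * cfc g a - cfc g b * w n) atTop (𝓝 0) := by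
  -- Both functional calculi are moved to one compact set, so that a single Stone–Weierstrass
  -- induction treats `a` and `b` together.
  set s : Set ℂ := spectrum ℂ a ∪ spectrum ℂ b
  have hs : CompactSpace s :=
    isCompact_iff_compactSpace.mp ((spectrum.isCompact a).union (spectrum.isCompact b))
  have has : spectrum ℂ a ⊆ s := Set.subset_union_left
  have hbs : spectrum ℂ b ⊆ s := Set.subset_union_right
  suffices key : ∀ f : C(s, ℂ), Tendsto
      (fun n => w n * cfcHomSuperset ha has f - cfcHomSuperset hb hbs f * w n) atTop (𝓝 0) by
    have h := key ⟨fun z => g z, by fun_prop⟩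
    have e1 : cfcHomSuperset ha has ⟨fun z => g z, by fun_prop⟩ = cfc g a := by
      rw [cfc_apply g a ha hg.continuousOn]; rfl
    have e2 : cfcHomSuperset hb hbs ⟨fun z => g z, by fun_prop⟩ = cfc g b := by
      rw [cfc_apply g b hb hg.continuousOn]; rfl
    rwa [e1, e2] at h
  intro f
  have bdd : ∀ {u : ℕ → H →L[ℂ] H} (_ : Tendsto u atTop (𝓝 0)) (c : H →L[ℂ] H),
      Tendsto (fun n => u n * c) atTop (𝓝 0) ∧ Tendsto (fun n => c * u n) atTop (𝓝 0) := by
    intro u hu c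
    exact ⟨by simpa using hu.mul_const c, by simpa using hu.const_mul c⟩
  induction f using ContinuousMap.induction_on_of_compact with
  | const r =>
    have e : ContinuousMap.const s r = algebraMap ℂ C(s, ℂ) r := rfl
    simp only [e, AlgHomClass.commutes, Algebra.commutes r, sub_self]
    exact tendsto_const_nhds
  | id => simpa only [cfcHomSuperset_id] using h1
  | star_id => simpa only [map_star, cfcHomSuperset_id] using h2
  | add f g hf hg =>
    have h := hf.add hg
    rw [add_zero] at h
    refine h.congr fun n => ?_
    rw [map_add, map_add]
    noncomm_ring
  | mul f g hf hg =>
    have h := (bdd hf (cfcHomSuperset ha has g)).1.add (bdd hg (cfcHomSuperset hb hbs f)).2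
    rw [add_zero] at h
    refine h.congr fun n => ?_
    rw [map_mul, map_mul]
    noncomm_ring
  -- Since the `w n` are contractions, replacing `f` by a nearby `g` costs at most `ε / 3` on each
  -- side, uniformly in `n`.
  | frequently f hf =>
    rw [Metric.tendsto_atTop]
    intro ε hε
    have c1 := (cfcHomSuperset_continuous ha has).tendsto f
    have c2 := (cfcHomSuperset_continuous hb hbs).tendsto f
    have d1 := Metric.tendsto_nhds.mp c1 (ε / 3) (by positivity)
    have d2 := Metric.tendsto_nhds.mp c2 (ε / 3) (by positivity)
    obtain ⟨g, hg, hg1, hg2⟩ := (hf.and_eventually (d1.and d2)).exists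
    obtain ⟨N, hN⟩ := Metric.tendsto_atTop.mp hg (ε / 3) (by positivity)
    refine ⟨N, fun n hn => ?_⟩
    have hn := hN n hn
    rw [dist_zero_right] at hn ⊢
    rw [dist_eq_norm] at hg1 hg2
    have e : w n * cfcHomSuperset ha has f - cfcHomSuperset hb hbs f * w n =
        (w n * cfcHomSuperset ha has g - cfcHomSuperset hb hbs g * w n) -
        w n * (cfcHomSuperset ha has g - cfcHomSuperset ha has f) +
        (cfcHomSuperset hb hbs g - cfcHomSuperset hb hbs f) * w n := by noncomm_ring
    have n1 : ‖w n * (cfcHomSuperset ha has g - cfcHomSuperset ha has f)‖ ≤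
        ‖cfcHomSuperset ha has g - cfcHomSuperset ha has f‖ :=
      (norm_mul_le _ _).trans (mul_le_of_le_one_left (norm_nonneg _) (hw n))
    have n2 : ‖(cfcHomSuperset hb hbs g - cfcHomSuperset hb hbs f) * w n‖ ≤
        ‖cfcHomSuperset hb hbs g - cfcHomSuperset hb hbs f‖ :=
      (norm_mul_le _ _).trans (mul_le_of_le_one_right (norm_nonneg _) (hw n))
    rw [e]
    refine (norm_add_le _ _).trans_lt ?_
    have n3 := norm_sub_le (w n * cfcHomSuperset ha has g - cfcHomSuperset hb hbs g * w n)
      (w n * (cfcHomSuperset ha has g - cfcHomSuperset ha has f))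
    linarith

/-- Moving `g` across `w n` leaves `g(b) (w n * a * star (w n))`. The factor `a` is essential: `w n
* star (w n)` need not tend to `1`. -/
theorem tendsto_conj_cfc_mul (a b : H →L[ℂ] H) [IsStarNormal a] [IsStarNormal b]
    {w : ℕ → H →L[ℂ] H} (hw : ∀ n, ‖w n‖ ≤ 1)
    (h1 : Tendsto (fun n => w n * a - b * w n) atTop (𝓝 0))
    (h2 : Tendsto (fun n => w n * star a - star b * w n) atTop (𝓝 0))
    (h3 : Tendsto (fun n => w n * a * star (w n)) atTop (𝓝 b))
    {g : ℂ → ℂ} (hg : Continuous g) :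
    Tendsto (fun n => w n * (cfc g a * a) * star (w n)) atTop (𝓝 (cfc g b * b)) := by
  have h4 := tendsto_intertwine_cfc a b hw h1 h2 hg
  have h5 : Tendsto (fun n => (w n * cfc g a - cfc g b * w n) * (a * star (w n))) atTop (𝓝 0) := by
    refine squeeze_zero_norm (fun n => ?_) (by simpa using h4.norm.mul_const ‖a‖)
    refine (norm_mul_le _ _).trans (mul_le_mul_of_nonneg_left ?_ (norm_nonneg _))
    refine (norm_mul_le _ _).trans (mul_le_of_le_one_right (norm_nonneg _) ?_)
    rw [norm_star]
    exact hw n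
  have h6 := h5.add (h3.const_mul (cfc g b))
  rw [zero_add] at h6
  refine h6.congr fun n => ?_
  noncomm_ring

/-! ### Range projections of limits and of orbit elements -/

theorem rangeProjection_apply_apply (T : H →L[ℂ] H) (x : H) : rangeProjection T (T x) = T x :=
  Submodule.starProjection_eq_self_iff.mpr
    (Submodule.le_topologicalClosure _ (LinearMap.mem_range_self _ x))

theorem mem_closure_range_of_rangeProjection_eq {T : H →L[ℂ] H} {y : H}
    (hy : rangeProjection T y = y) : y ∈ closure (Set.range T) :=
  Submodule.starProjection_eq_self_iff.mp hy

/-- Linearly independent families pass to approximants. -/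
theorem exists_linearIndependent_of_tendsto {S T : H →L[ℂ] H} {u w : ℕ → H →L[ℂ] H}
    (h : Tendsto (fun n => u n * T * w n) atTop (𝓝 S)) {k : ℕ} {y : Fin k → H}
    (hy : LinearIndependent ℂ y) (hSy : ∀ i, rangeProjection S (y i) = y i) :
    ∃ z : Fin k → H, LinearIndependent ℂ z ∧ ∀ i, rangeProjection T (z i) = z i := by
  have ho : IsOpen {f : Fin k → H | LinearIndependent ℂ f} := isOpen_setOfPred_linearIndependent
  -- The `y i` lie only in the closure of the range of `S`; openness of linear independence allows
  -- them to be moved into the range itself.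
  have h1 : y ∈ closure (Set.univ.pi fun _ : Fin k => Set.range S) := by
    rw [closure_pi_set]
    exact fun i _ => mem_closure_range_of_rangeProjection_eq (hSy i)
  obtain ⟨y', hy', hy'S⟩ := mem_closure_iff.mp h1 _ ho hy
  choose x hx using fun i => hy'S i (Set.mem_univ i)
  have h2 : Tendsto (fun n i => (u n * T * w n) (x i)) atTop (𝓝 fun i => S (x i)) :=
    tendsto_pi_nhds.mpr fun i => ((ContinuousLinearMap.apply ℂ H (x i)).continuous.tendsto S).comp h
  have h3 : (fun i => S (x i)) = y' := funext hx
  rw [h3] at h2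
  obtain ⟨n, hn⟩ := (h2.eventually (ho.mem_nhds hy')).exists
  -- Vectors with linearly independent images under `u n` are independent, so `u n` can be dropped.
  refine ⟨fun i => T (w n (x i)), ?_, fun i => rangeProjection_apply_apply T _⟩
  exact LinearIndependent.of_comp (u n).toLinearMap hn

/-- Normality gives `a` and `star a` the same kernel, so the projection that supports `a` on the
left also supports it on the right. -/
theorem mul_rangeProjection (a : H →L[ℂ] H) [ha : IsStarNormal a] :
    a * rangeProjection a = a := by
  have h1 : rangeProjection a * a = a :=
    ContinuousLinearMap.ext fun x => rangeProjection_apply_apply a x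
  have hp : IsStarProjection (rangeProjection a) := isStarProjection_starProjection
  have h2 : star a * rangeProjection a = star a := by
    have := congrArg star h1
    rwa [star_mul, hp.isSelfAdjoint.star_eq] at this
  refine (sub_eq_zero.mp (ContinuousLinearMap.ext fun x => ?_)).symm
  have h3 := ContinuousLinearMap.isStarNormal_iff_norm_eq_adjoint.mp ha (x - rangeProjection a x)
  have h4 : star a (x - rangeProjection a x) = 0 := by
    rw [map_sub, sub_eq_zero]
    exact (congrArg (fun T : H →L[ℂ] H => T x) h2).symm
  rw [← ContinuousLinearMap.star_eq_adjoint, h4, norm_zero, norm_eq_zero] at h3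
  rw [map_sub] at h3
  exact h3

/-- All the identities are exact because `star v * v` is absorbed by `a` and `star a` from both
sides. -/
theorem exists_intertwiner_of_mem_groupoidOrbit (a : H →L[ℂ] H) [IsStarNormal a] {x : H →L[ℂ] H}
    (hx : x ∈ groupoidOrbit a) : ∃ v : H →L[ℂ] H, ‖v‖ ≤ 1 ∧ v * a = x * v ∧
      v * star a = star x * v ∧ star v * x = a * star v ∧ star v * star x = star a * star v ∧
      v * a * star v = x ∧ star v * x * v = a := by
  obtain ⟨v, hv, rfl⟩ := hx
  have h1 : rangeProjection a * a = a :=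
    ContinuousLinearMap.ext fun x => rangeProjection_apply_apply a x
  have h2 := mul_rangeProjection a
  have hp : IsStarProjection (rangeProjection a) := isStarProjection_starProjection
  have h3 := congrArg star h1
  have h4 := congrArg star h2
  rw [star_mul, hp.isSelfAdjoint.star_eq] at h3 h4
  refine ⟨v, ?_, ?_, ?_, ?_, ?_, rfl, ?_⟩
  · have h : ‖v‖ * ‖v‖ ≤ 1 := by
      rw [← CStarRing.norm_star_mul_self, hv]
      exact Submodule.starProjection_norm_le _
    nlinarith [norm_nonneg v]
  · rw [mul_assoc _ (star v) v, hv, mul_assoc, h2]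
  · rw [star_mul, star_mul, star_star, mul_assoc, mul_assoc, hv, h3]
  · rw [← mul_assoc, ← mul_assoc, hv, h1]
  · rw [star_mul, star_mul, star_star, ← mul_assoc, hv, ← mul_assoc, h4]
  · rw [mul_assoc, mul_assoc _ (star v) v, hv, mul_assoc, h2, ← mul_assoc, hv, h1]

/-! ### Murray–von Neumann equivalence and dimension -/

theorem MurrayVonNeumannEquiv.symm {p q : H →L[ℂ] H} (h : MurrayVonNeumannEquiv p q) :
    MurrayVonNeumannEquiv q p := by
  obtain ⟨v, h1, h2⟩ := h
  exact ⟨star v, by rw [star_star, h2], by rw [star_star, h1]⟩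

theorem MurrayVonNeumannEquiv.eq_zero {p q : H →L[ℂ] H} (h : MurrayVonNeumannEquiv p q)
    (hp : p = 0) : q = 0 := by
  obtain ⟨v, h1, h2⟩ := h
  rw [hp, CStarRing.star_mul_self_eq_zero_iff] at h1
  rw [← h2, h1, zero_mul]

/-- Murray–von Neumann equivalence of projections on a separable space is decided by the sizes of
linearly independent families in their ranges. -/
theorem murrayVonNeumannEquiv_of_linearIndependent [TopologicalSpace.SeparableSpace H]
    {P Q : H →L[ℂ] H} (hP : IsStarProjection P) (hQ : IsStarProjection Q)
    (h1 : ∀ (k : ℕ) (y : Fin k → H), LinearIndependent ℂ y → (∀ i, P (y i) = y i) →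
      ∃ z : Fin k → H, LinearIndependent ℂ z ∧ ∀ i, Q (z i) = z i)
    (h2 : ∀ (k : ℕ) (y : Fin k → H), LinearIndependent ℂ y → (∀ i, Q (y i) = y i) →
      ∃ z : Fin k → H, LinearIndependent ℂ z ∧ ∀ i, P (z i) = z i) :
    MurrayVonNeumannEquiv P Q := by
  obtain ⟨A, e, he⟩ := exists_isRangeBasis hP
  obtain ⟨B, f, hf⟩ := exists_isRangeBasis hQ
  have hA := countable_of_orthonormal he.orthonormal
  have hB := countable_of_orthonormal hf.orthonormal
  have key : ∀ {P Q : H →L[ℂ] H} (_ : IsStarProjection P) (_ : IsStarProjection Q)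
      (_ : ∀ (k : ℕ) (y : Fin k → H), LinearIndependent ℂ y → (∀ i, P (y i) = y i) →
        ∃ z : Fin k → H, LinearIndependent ℂ z ∧ ∀ i, Q (z i) = z i) {A B : Type u} {e : A → H}
      {f : B → H} (_ : IsRangeBasis P e) (_ : IsRangeBasis Q f), ENat.card A ≤ ENat.card B := by
    intro P Q hP hQ h A B e f he hf
    refine ENat.forall_natCast_le_iff_le.mp fun k hk => ?_
    rcases finite_or_infinite B with hB | hB
    · have := Fintype.ofFinite B
      have hk' : Nonempty (Fin k ↪ A) := by
        rcases finite_or_infinite A with hA | hA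
        · have := Fintype.ofFinite A
          rw [ENat.card_eq_coe_fintype_card] at hk
          exact Function.Embedding.nonempty_of_card_le
            (by rw [Fintype.card_fin]; exact_mod_cast hk)
        · exact ⟨Fin.valEmbedding.trans (Infinite.natEmbedding A)⟩
      obtain ⟨φ⟩ := hk'
      obtain ⟨z, hz, hzQ⟩ := h k (e ∘ φ) (he.orthonormal.comp φ φ.injective).linearIndependent
        fun i => he.apply_eq_self hP _
      have := card_le_of_isRangeBasis hQ hf hz hzQ
      rw [ENat.card_eq_coe_fintype_card]
      exact_mod_cast this
    · rw [ENat.card_eq_top_of_infinite]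
      exact le_top
  have hcard : ENat.card A = ENat.card B := le_antisymm (key hP hQ h1 he hf) (key hQ hP h2 hf he)
  -- `ENat.card` does not distinguish infinite cardinals; separability makes both index types
  -- countable, which settles the infinite case.
  have hAB : Nonempty (A ≃ B) := by
    rcases finite_or_infinite A with hA' | hA'
    · have hB' : Finite B := by
        rw [← ENat.card_lt_top, ← hcard]
        exact ENat.card_lt_top.mpr hA'
      have := Fintype.ofFinite A
      have := Fintype.ofFinite B
      rw [ENat.card_eq_coe_fintype_card, ENat.card_eq_coe_fintype_card] at hcard
      exact ⟨Fintype.equivOfCardEq (by exact_mod_cast hcard)⟩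
    · have hB' : Infinite B := by
        rw [← ENat.card_eq_top, ← hcard]
        exact ENat.card_eq_top.mpr hA'
      exact nonempty_equiv_of_countable
  exact murrayVonNeumannEquiv_of_equiv hP hQ he hf hAB.some

/-- Conjugation by `v n` and by `star (v n)` yields the two limits `t1` and `t2`, which bound the
two ranks by each other. -/
theorem murrayVonNeumannEquiv_spectralMeasure_of_mem_closure
    [TopologicalSpace.SeparableSpace H] (a b : H →L[ℂ] H) [IsStarNormal a] [IsStarNormal b]
    (h : b ∈ closure (groupoidOrbit a)) {Δ : Set ℂ} (hΔ : IsOpen Δ) (h0 : Δ ⊆ {0}ᶜ) :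
    MurrayVonNeumannEquiv (spectralMeasure a Δ) (spectralMeasure b Δ) := by
  obtain ⟨x, hx, hxb⟩ := mem_closure_iff_seq_limit.mp h
  choose v hv1 hva hva' hvx hvx' hvax hvxa using
    fun n => exists_intertwiner_of_mem_groupoidOrbit a (hx n)
  have hd : Tendsto (fun n => x n - b) atTop (𝓝 0) := by
    simpa using hxb.sub_const b
  have hv1' : ∀ n, ‖star (v n)‖ ≤ 1 := fun n => by rw [norm_star]; exact hv1 n
  have small : ∀ {u s t : ℕ → H →L[ℂ] H} (_ : Tendsto u atTop (𝓝 0)) (_ : ∀ n, ‖s n‖ ≤ 1)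
      (_ : ∀ n, ‖t n‖ ≤ 1), Tendsto (fun n => s n * u n * t n) atTop (𝓝 0) := by
    intro u s t hu hs ht
    refine squeeze_zero_norm (fun n => ?_) (by simpa using hu.norm)
    refine (norm_mul_le _ _).trans ((mul_le_of_le_one_right (norm_nonneg _) (ht n)).trans ?_)
    exact (norm_mul_le _ _).trans (mul_le_of_le_one_left (norm_nonneg _) (hs n))
  have hd' : Tendsto (fun n => star (x n - b)) atTop (𝓝 0) := by
    simpa using hd.star
  have h1 : ‖(1 : H →L[ℂ] H)‖ ≤ 1 := ContinuousLinearMap.norm_id_le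
  let g : ℂ → ℝ := fun z => Metric.infDist z Δᶜ
  have hg : Continuous g := Metric.continuous_infDist_pt _
  have hgc : Continuous fun z => (g z : ℂ) := Complex.continuous_ofReal.comp hg
  have hset : {z : ℂ | g z * ‖z‖ ≠ 0} = Δ := by
    -- `Metric.infDist` to an empty set is `0`, so the complement must be nonempty for `g` to detect
    -- `Δ`. The extra factor `‖z‖` loses nothing since `0 ∉ Δ`.
    have hne : (Δᶜ).Nonempty := ⟨0, fun h => h0 h rfl⟩
    ext z
    simp only [Set.mem_ofPred_eq, mul_ne_zero_iff, norm_ne_zero_iff]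
    have : g z = 0 ↔ z ∈ Δᶜ := (hΔ.isClosed_compl.mem_iff_infDist_zero hne).symm
    rw [Ne, this, Set.notMem_compl_iff]
    exact ⟨fun h => h.1, fun h => ⟨h, h0 h⟩⟩
  have t1 : Tendsto (fun n => v n * (cfc (fun z => (g z : ℂ)) a * a) * star (v n)) atTop
      (𝓝 (cfc (fun z => (g z : ℂ)) b * b)) := by
    refine tendsto_conj_cfc_mul a b hv1 ?_ ?_ ?_ hgc
    · refine (small hd (fun _ => h1) hv1).congr fun n => ?_
      rw [hva]; noncomm_ring
    · refine (small hd' (fun _ => h1) hv1).congr fun n => ?_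
      rw [hva', star_sub]; noncomm_ring
    · simpa only [hvax] using hxb
  have t2 : Tendsto (fun n => star (v n) * (cfc (fun z => (g z : ℂ)) b * b) * v n) atTop
      (𝓝 (cfc (fun z => (g z : ℂ)) a * a)) := by
    have := tendsto_conj_cfc_mul b a hv1' ?_ ?_ ?_ hgc
    · simpa only [star_star] using this
    · have := (small hd hv1' (fun _ => h1)).neg
      rw [neg_zero] at this
      refine this.congr fun n => ?_
      rw [← hvx]; noncomm_ring
    · have := (small hd' hv1' (fun _ => h1)).neg
      rw [neg_zero] at this
      refine this.congr fun n => ?_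
      rw [← hvx', star_sub]; noncomm_ring
    -- Since `star (v n) * x n * v n = a` exactly, compressing `b` instead of `x n` changes `a` only
    -- by the compression of `x n - b`.
    · have := (small hd hv1' hv1).const_sub a
      rw [sub_zero] at this
      refine this.congr fun n => ?_
      rw [star_star]
      nth_rw 1 [← hvxa n]
      noncomm_ring
  have ea := rangeProjection_cfc_mul a hg
  have eb := rangeProjection_cfc_mul b hg
  rw [hset] at ea eb
  refine murrayVonNeumannEquiv_of_linearIndependent
    (isStarProjection_spectralMeasure a hΔ.measurableSet)
    (isStarProjection_spectralMeasure b hΔ.measurableSet) (fun k y hy hPy => ?_)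
    fun k y hy hPy => ?_
  · rw [← ea] at hPy
    rw [← eb]
    exact exists_linearIndependent_of_tendsto t2 hy hPy
  · rw [← eb] at hPy
    rw [← ea]
    exact exists_linearIndependent_of_tendsto t1 hy hPy

theorem spectrum_subset_of_murrayVonNeumannEquiv (a b : H →L[ℂ] H) [IsStarNormal a]
    [IsStarNormal b] (h : ∀ Δ : Set ℂ, IsOpen Δ → Δ ⊆ {0}ᶜ →
      MurrayVonNeumannEquiv (spectralMeasure a Δ) (spectralMeasure b Δ)) :
    spectrum ℂ a ∪ {0} ⊆ spectrum ℂ b ∪ {0} := by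
  rintro l (hl | hl)
  · by_cases hl0 : l = 0
    · exact Or.inr hl0
    left
    rw [mem_spectrum_iff_spectralMeasure_ball_ne_zero] at hl ⊢
    intro r hr hb
    -- The equivalence is available only for open sets avoiding `0`, so the ball is shrunk to
    -- exclude it.
    have hsub : Metric.ball l (min r ‖l‖) ⊆ {0}ᶜ := by
      rintro z hz rfl
      rw [Metric.mem_ball, dist_zero_left] at hz
      exact absurd hz (not_lt.mpr (min_le_right _ _))
    refine hl (min r ‖l‖) (lt_min hr (norm_pos_iff.mpr hl0))
      ((h _ Metric.isOpen_ball hsub).symm.eq_zero (ContinuousLinearMap.ext fun x => ?_))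
    refine (spectralMeasure_apply_eq_zero_iff b measurableSet_ball x).mpr
      (measure_mono_null (Metric.ball_subset_ball (min_le_left _ _)) ?_)
    rw [← spectralMeasure_apply_eq_zero_iff b measurableSet_ball x, hb]
    rfl
  · exact Or.inr hl

/-! ### Matching -/

/-- A version of Hall's marriage theorem where the admissible partners are given by finitely many
classes, each of which may be infinite. -/
theorem exists_injective_of_hall {A B ι : Type*} [Finite ι] [Countable A] (j : B → ι)
    (r : A → ι → Prop)
    (hall : ∀ (S : Finset A) (F : Finset B), (∀ β, β ∈ F ↔ ∃ s ∈ S, r s (j β)) →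
      S.card ≤ F.card) :
    ∃ φ : A → B, Function.Injective φ ∧ ∀ α, r α (j (φ α)) := by
  classical
  -- Elements with finitely many partners are matched by the finite Hall theorem. Any other element
  -- has an infinite admissible class, as there are finitely many classes, and all of `A` embeds
  -- into each infinite class.
  let N : A → Set B := fun α => {β | r α (j β)}
  let t : {α // (N α).Finite} → Finset B := fun α => α.2.toFinset
  obtain ⟨f, hf, hft⟩ := (Finset.all_card_le_biUnion_card_iff_exists_injective t).mp fun s => by
    have := hall (s.map (Function.Embedding.subtype _)) (s.biUnion t) fun β => by
      simp [t, N]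
    simpa using this
  have hft' : ∀ α, r α.1 (j (f α)) := fun α => by
    have := hft α
    simpa [t, N] using this
  have hinf : ∀ α : {α // ¬ (N α).Finite}, ∃ k, r α k ∧ (j ⁻¹' {k}).Infinite := by
    rintro ⟨α, hα⟩
    by_contra! hcon
    refine hα ((Set.finite_iUnion fun k : {k // r α k} =>
      hcon k.1 k.2).subset fun β hβ => ?_)
    exact Set.mem_iUnion.mpr ⟨⟨j β, hβ⟩, rfl⟩
  choose κ hκ hκi using hinf
  have hemb : ∀ k : {k // (j ⁻¹' {k}).Infinite}, ∃ c : A → B, Function.Injective c ∧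
      ∀ α, j (c α) = k := by
    rintro ⟨k, hk⟩
    have : Infinite (j ⁻¹' {k}) := hk.to_subtype
    obtain ⟨n, hn⟩ := exists_injective_nat A
    exact ⟨fun α => (Infinite.natEmbedding (j ⁻¹' {k}) (n α) : B),
      fun α α' h => hn ((Infinite.natEmbedding _).injective (Subtype.ext h)),
      fun α => (Infinite.natEmbedding (j ⁻¹' {k}) (n α)).2⟩
  choose c hc hcj using hemb
  refine ⟨fun α => if h : (N α).Finite then f ⟨α, h⟩ else c ⟨κ ⟨α, h⟩, hκi _⟩ α, ?_, ?_⟩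
  -- A collision would make the whole infinite class of `α'` admissible for `α`, contradicting
  -- finiteness of `N α`.
  · have mixed : ∀ (α α' : A) (h : (N α).Finite) (h' : ¬ (N α').Finite),
        f ⟨α, h⟩ ≠ c ⟨κ ⟨α', h'⟩, hκi _⟩ α' := by
      intro α α' h h' he
      refine hκi ⟨α', h'⟩ (h.subset fun β hβ => ?_)
      have h1 := hft' ⟨α, h⟩
      rw [he, hcj] at h1
      change r α (j β)
      rw [show j β = κ ⟨α', h'⟩ from hβ]
      exact h1
    intro α α' he
    by_cases h : (N α).Finite <;> by_cases h' : (N α').Finite <;> simp only [h, h', dif_pos,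
      dif_neg, not_false_eq_true] at he
    · exact congrArg Subtype.val (hf he)
    · exact absurd he (mixed _ _ h h')
    · exact absurd he.symm (mixed _ _ h' h)
    · have hk : κ ⟨α, h⟩ = κ ⟨α', h'⟩ := by
        have := congrArg j he
        rwa [hcj, hcj] at this
      have hk' : (⟨κ ⟨α, h⟩, hκi _⟩ : {k // (j ⁻¹' {k}).Infinite}) = ⟨κ ⟨α', h'⟩, hκi _⟩ :=
        Subtype.ext hk
      rw [← hk'] at he
      exact hc _ he
  · intro α
    by_cases h : (N α).Finite
    · simpa only [h, dif_pos] using hft' ⟨α, h⟩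
    · simpa only [h, dif_neg, not_false_eq_true, hcj] using hκ ⟨α, h⟩

/-! ### Bases adapted to a partition of the plane -/

/-- An orthonormal basis of the range of `E^a(⋃ Sᵢ)` each of whose vectors lies in the range of some
`E^a(Sᵢ)`. -/
structure IsAdaptedBasis (a : H →L[ℂ] H) [IsStarNormal a] {ι A : Type*} [Fintype ι]
    (S : ι → Set ℂ) (cell : A → ι) (e : A → H) : Prop where
  isRangeBasis : IsRangeBasis (spectralMeasure a (⋃ i, S i)) e
  apply_eq_self : ∀ α, spectralMeasure a (S (cell α)) (e α) = e α
  -- The quadratic form of `∑ c i • E^a(S i)`, read as that of a diagonal operator in the basis `e`.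
  hasSum_weight : ∀ (c : ι → ℂ) (y : H), HasSum
    (fun α => ((‖⟪e α, y⟫_ℂ‖ ^ 2 : ℝ) : ℂ) * c (cell α))
    (∑ i, (((scalarSpectralMeasure a y).real (S i) : ℝ) : ℂ) * c i)

theorem spectralMeasure_apply_apply (a : H →L[ℂ] H) [IsStarNormal a] {Δ Γ : Set ℂ}
    (hΔ : MeasurableSet Δ) (hΓ : MeasurableSet Γ) (x : H) :
    spectralMeasure a Δ (spectralMeasure a Γ x) = spectralMeasure a (Δ ∩ Γ) x := by
  rw [← spectralMeasure_inter a hΔ hΓ]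
  rfl

theorem inner_spectralMeasure_left (a : H →L[ℂ] H) [IsStarNormal a] {Δ : Set ℂ}
    (hΔ : MeasurableSet Δ) (x y : H) :
    ⟪spectralMeasure a Δ x, y⟫_ℂ = ⟪x, spectralMeasure a Δ y⟫_ℂ :=
  (isSelfAdjoint_spectralMeasure a hΔ).isSymmetric x y

theorem spectralMeasure_empty (a : H →L[ℂ] H) [IsStarNormal a] :
    spectralMeasure a ∅ = 0 :=
  ext_diag fun x => by rw [inner_spectralMeasure a MeasurableSet.empty]; simp

theorem exists_isAdaptedBasis (a : H →L[ℂ] H) [IsStarNormal a] {ι : Type} [Fintype ι]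
    {S : ι → Set ℂ} (hS : ∀ i, MeasurableSet (S i)) (hd : Pairwise (Function.onFun Disjoint S)) :
    ∃ (A : Type u) (cell : A → ι) (e : A → H), IsAdaptedBasis a S cell e := by
  classical
  choose A e he using fun i => exists_isRangeBasis (isStarProjection_spectralMeasure a (hS i))
  have hself : ∀ α : (Σ i, A i), spectralMeasure a (S α.1) (e α.1 α.2) = e α.1 α.2 := fun α =>
    (he α.1).apply_eq_self (isStarProjection_spectralMeasure a (hS α.1)) α.2
  have ho : Orthonormal ℂ fun α : (Σ i, A i) => e α.1 α.2 := by
    refine ⟨fun α => (he α.1).orthonormal.norm_eq_one α.2, ?_⟩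
    rintro ⟨i, α⟩ ⟨j, β⟩ hne
    by_cases hij : i = j
    · subst hij
      exact (he i).orthonormal.inner_eq_zero fun h => hne (Sigma.ext rfl (heq_of_eq h))
    · change ⟪e i α, e j β⟫_ℂ = 0
      rw [← hself ⟨i, α⟩, ← hself ⟨j, β⟩, inner_spectralMeasure_left a (hS i),
        spectralMeasure_apply_apply a (hS i) (hS j), (hd hij).inter_eq, spectralMeasure_empty]
      simp
  have hfib : ∀ i y, HasSum (fun α : A i => ‖⟪e i α, y⟫_ℂ‖ ^ 2)
      ((scalarSpectralMeasure a y).real (S i)) := fun i y => by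
    rw [← norm_sq_spectralMeasure_apply a (hS i)]
    exact (he i).hasSum y
  have hsum : ∀ y, Summable fun α : (Σ i, A i) => ‖⟪e α.1 α.2, y⟫_ℂ‖ ^ 2 := fun y =>
    ho.inner_products_summable y
  refine ⟨Σ i, A i, Sigma.fst, fun α => e α.1 α.2, ⟨ho, fun y => ?_⟩, hself, fun c y => ?_⟩
  · rw [norm_sq_spectralMeasure_apply a (MeasurableSet.iUnion hS),
      measureReal_iUnion_fintype hd hS]
    exact HasSum.sigma_of_hasSum (hasSum_fintype _) (fun i => hfib i y) (hsum y)
  · refine HasSum.sigma_of_hasSum (hasSum_fintype _)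
      (fun i => (Complex.hasSum_ofReal.mpr (hfib i y)).mul_right (c i)) ?_
    obtain ⟨C, hC⟩ := (Set.finite_range fun i => ‖c i‖).bddAbove
    refine Summable.of_norm_bounded ((hsum y).mul_right C) fun α => ?_
    rw [norm_mul, Complex.norm_real, Real.norm_of_nonneg (by positivity)]
    exact mul_le_mul_of_nonneg_left (hC (Set.mem_range_self _)) (by positivity)

/-- Hall's condition for adapted bases. -/
theorem card_le_card_of_murrayVonNeumannEquiv (a b : H →L[ℂ] H) [IsStarNormal a] [IsStarNormal b]
    {ι A B : Type*} [Fintype ι] {S : ι → Set ℂ} (hS : ∀ i, MeasurableSet (S i))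
    {cellA : A → ι} {cellB : B → ι} {e : A → H} {f : B → H}
    (he : IsAdaptedBasis a S cellA e) (hf : IsAdaptedBasis b S cellB f)
    {U : Set ℂ} (hU : MeasurableSet U) (hUS : U ⊆ ⋃ i, S i)
    (hv : MurrayVonNeumannEquiv (spectralMeasure a U) (spectralMeasure b U))
    (s : Finset A) (F : Finset B) (hs : ∀ α ∈ s, S (cellA α) ⊆ U)
    (hF : ∀ β, β ∉ F → Disjoint U (S (cellB β))) : s.card ≤ F.card := by
  classical
  obtain ⟨v, hv1, hv2⟩ := hv
  have hv1' : ∀ x, star v (v x) = spectralMeasure a U x := fun x =>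
    congrArg (fun T : H →L[ℂ] H => T x) hv1
  have hv2' : ∀ x, v (star v x) = spectralMeasure b U x := fun x =>
    congrArg (fun T : H →L[ℂ] H => T x) hv2
  have hUe : ∀ α ∈ s, spectralMeasure a U (e α) = e α := fun α hα => by
    rw [← he.apply_eq_self α, spectralMeasure_apply_apply a hU (hS _),
      Set.inter_eq_right.mpr (hs α hα)]
  let y : s → H := fun α => v (e α)
  have hy : Orthonormal ℂ y := by
    have h := he.isRangeBasis.orthonormal.comp (Subtype.val : s → A) Subtype.val_injective
    rw [orthonormal_iff_ite] at h ⊢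
    intro α β
    rw [← h α β, ← ContinuousLinearMap.adjoint_inner_right, ← ContinuousLinearMap.star_eq_adjoint,
      hv1', hUe _ β.2]
    rfl
  have hyU : ∀ α, spectralMeasure b U (y α) = y α := fun α => by
    rw [← hv2', hv1', hUe _ α.2]
  -- Double counting: only indices in `F` contribute to Parseval for `y α`, so each row sums to `1`,
  -- while Bessel bounds each column by `1`.
  have hyF : ∀ α, ∑ β ∈ F, ‖⟪f β, y α⟫_ℂ‖ ^ 2 = 1 := by
    intro α
    have h1 := hf.isRangeBasis.hasSum (y α)
    rw [← hyU α, spectralMeasure_apply_apply b (MeasurableSet.iUnion hS) hU,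
      Set.inter_eq_right.mpr hUS, hyU, hy.norm_eq_one, one_pow] at h1
    refine (h1.unique (hasSum_sum_of_ne_finset_zero fun β hβ => ?_)).symm
    rw [← hyU α, ← inner_spectralMeasure_left b hU, ← hf.apply_eq_self β,
      spectralMeasure_apply_apply b hU (hS _), (hF β hβ).inter_eq, spectralMeasure_empty]
    simp
  have h2 : ∀ β, ∑ α : s, ‖⟪f β, y α⟫_ℂ‖ ^ 2 ≤ 1 := by
    intro β
    have h := hy.sum_inner_products_le (f β) (s := Finset.univ)
    rw [hf.isRangeBasis.orthonormal.norm_eq_one, one_pow] at h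
    simpa only [norm_inner_symm] using h
  have h3 : (s.card : ℝ) ≤ F.card := by
    calc (s.card : ℝ) = ∑ α : s, ∑ β ∈ F, ‖⟪f β, y α⟫_ℂ‖ ^ 2 := by simp [hyF]
      _ = ∑ β ∈ F, ∑ α : s, ‖⟪f β, y α⟫_ℂ‖ ^ 2 := Finset.sum_comm
      _ ≤ ∑ β ∈ F, 1 := Finset.sum_le_sum fun β _ => h2 β
      _ = F.card := by simp
  exact_mod_cast h3

/-! ### Approximation by elements of the groupoid orbit -/

omit [CompleteSpace H] in
/-- The norm of an operator is at most twice its numerical radius. -/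
theorem norm_le_two_mul_of_inner_le {T : H →L[ℂ] H} {η : ℝ} (hη : 0 ≤ η)
    (h : ∀ x, ‖⟪x, T x⟫_ℂ‖ ≤ η * ‖x‖ ^ 2) : ‖T‖ ≤ 2 * η := by
  have key : ∀ x y, ‖⟪x, T y⟫_ℂ‖ ≤ η * (‖x‖ ^ 2 + ‖y‖ ^ 2) := by
    intro x y
    have e : ⟪x, T y⟫_ℂ = (⟪x + y, T (x + y)⟫_ℂ - ⟪x - y, T (x - y)⟫_ℂ
        - Complex.I * ⟪x + Complex.I • y, T (x + Complex.I • y)⟫_ℂ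
        + Complex.I * ⟪x - Complex.I • y, T (x - Complex.I • y)⟫_ℂ) / 4 := by
      simp only [map_add, map_sub, map_smul, inner_add_left, inner_add_right, inner_sub_left,
        inner_sub_right, inner_smul_left, inner_smul_right, Complex.conj_I]
      ring_nf
      simp only [Complex.I_sq]
      ring
    have p1 := parallelogram_law_with_norm ℂ x y
    have p2 := parallelogram_law_with_norm ℂ x (Complex.I • y)
    rw [norm_smul, Complex.norm_I, one_mul] at p2
    have n1 := norm_add_le (⟪x + y, T (x + y)⟫_ℂ - ⟪x - y, T (x - y)⟫_ℂ
        - Complex.I * ⟪x + Complex.I • y, T (x + Complex.I • y)⟫_ℂ)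
        (Complex.I * ⟪x - Complex.I • y, T (x - Complex.I • y)⟫_ℂ)
    have n2 := norm_sub_le (⟪x + y, T (x + y)⟫_ℂ - ⟪x - y, T (x - y)⟫_ℂ)
        (Complex.I * ⟪x + Complex.I • y, T (x + Complex.I • y)⟫_ℂ)
    have n3 := norm_sub_le ⟪x + y, T (x + y)⟫_ℂ ⟪x - y, T (x - y)⟫_ℂ
    rw [norm_mul, Complex.norm_I, one_mul] at n1 n2
    have h1 := h (x + y)
    have h2 := h (x - y)
    have h3 := h (x + Complex.I • y)
    have h4 := h (x - Complex.I • y)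
    rw [e, norm_div, Complex.norm_ofNat, div_le_iff₀ (by norm_num)]
    have p1' := congrArg (η * ·) p1
    have p2' := congrArg (η * ·) p2
    linarith
  refine T.opNorm_le_bound (by positivity) fun y => ?_
  by_cases hTy : T y = 0
  · rw [hTy, norm_zero]; positivity
  have hT : 0 < ‖T y‖ := norm_pos_iff.mpr hTy
  have hy : 0 < ‖y‖ := norm_pos_iff.mpr fun h0 => hTy (by rw [h0, map_zero])
  -- Rescaling `T y` to the norm of `y` balances the two squares in `key`.
  have h1 := key (((‖y‖ / ‖T y‖ : ℝ) : ℂ) • T y) y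
  rw [inner_smul_left, inner_self_eq_ofReal_norm_sq, norm_smul, norm_mul, RCLike.norm_conj,
    Complex.norm_real, Complex.norm_real, Real.norm_of_nonneg (by positivity),
    Real.norm_of_nonneg (by positivity)] at h1
  have h2 : ‖y‖ / ‖T y‖ * ‖T y‖ ^ 2 = ‖y‖ * ‖T y‖ := by field_simp
  have h3 : ‖y‖ / ‖T y‖ * ‖T y‖ = ‖y‖ := by field_simp
  rw [h2, h3] at h1
  refine le_of_mul_le_mul_left ?_ hy
  linarith

theorem ae_norm_lt (a : H →L[ℂ] H) [IsStarNormal a] {K : ℝ} (hK : ‖a‖ < K) (y : H) :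
    ∀ᵐ z ∂(scalarSpectralMeasure a y), ‖z‖ < K := by
  have h : ∀ᵐ z ∂(scalarSpectralMeasure a y), z ∈ spectrum ℂ a :=
    scalarSpectralMeasure_compl_spectrum a y
  filter_upwards [h] with z hz
  refine (spectrum.norm_le_norm_mul_of_mem hz).trans_lt (lt_of_le_of_lt ?_ hK)
  exact mul_le_of_le_one_right (norm_nonneg _) ContinuousLinearMap.norm_id_le

/-- The quadratic form of `a` is approximated by sums over a partition of the punctured disc. -/
theorem norm_inner_sub_sum_le (a : H →L[ℂ] H) [IsStarNormal a] {K : ℝ} (hK : ‖a‖ < K)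
    {ι : Type*} [Fintype ι] {S : ι → Set ℂ} (hS : ∀ i, MeasurableSet (S i))
    (hd : Pairwise (Function.onFun Disjoint S)) (hD : ⋃ i, S i = {z | z ≠ 0 ∧ ‖z‖ < K})
    {c : ι → ℂ} {δ : ℝ} (hδ : 0 ≤ δ) (hc : ∀ i, ∀ z ∈ S i, dist z (c i) < δ) (y : H) :
    ‖⟪y, a y⟫_ℂ - ∑ i, (((scalarSpectralMeasure a y).real (S i) : ℝ) : ℂ) * c i‖ ≤
      δ * ‖y‖ ^ 2 := by
  have hint : Integrable (fun z : ℂ => z) (scalarSpectralMeasure a y) :=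
    integrable_scalarSpectralMeasure a y continuous_id
  -- Outside the cells the integrand vanishes at `0`, and there is no mass where `‖z‖ ≥ K`.
  have h1 : ∫ z, z ∂(scalarSpectralMeasure a y) =
      ∫ z in ⋃ i, S i, z ∂(scalarSpectralMeasure a y) := by
    refine (setIntegral_eq_integral_of_ae_compl_eq_zero ?_).symm
    filter_upwards [ae_norm_lt a hK y] with z hz hzS
    rw [hD] at hzS
    by_contra h0
    exact hzS ⟨h0, hz⟩
  rw [inner_eq_integral_spectralMeasure, h1,
    integral_iUnion_fintype hS hd fun i => hint.integrableOn, ← Finset.sum_sub_distrib]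
  have h2 : ∀ i, ‖(∫ z in S i, z ∂(scalarSpectralMeasure a y)) -
      (((scalarSpectralMeasure a y).real (S i) : ℝ) : ℂ) * c i‖ ≤
      δ * (scalarSpectralMeasure a y).real (S i) := by
    intro i
    have e : (∫ z in S i, z ∂(scalarSpectralMeasure a y)) -
        (((scalarSpectralMeasure a y).real (S i) : ℝ) : ℂ) * c i =
        ∫ z in S i, (z - c i) ∂(scalarSpectralMeasure a y) := by
      rw [integral_sub hint.integrableOn (integrable_const _), setIntegral_const,
        Complex.real_smul]
    rw [e]
    refine norm_setIntegral_le_of_norm_le_const (measure_lt_top _ _) fun z hz => ?_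
    rw [← dist_eq_norm]
    exact (hc i z hz).le
  calc _ ≤ ∑ i, δ * (scalarSpectralMeasure a y).real (S i) := norm_sum_le_of_le _ fun i _ => h2 i
    _ = δ * (scalarSpectralMeasure a y).real (⋃ i, S i) := by
      rw [← Finset.mul_sum, measureReal_iUnion_fintype hd hS]
    _ ≤ δ * (scalarSpectralMeasure a y).real Set.univ :=
      mul_le_mul_of_nonneg_left (measureReal_mono (Set.subset_univ _)) hδ
    _ = δ * ‖y‖ ^ 2 := by rw [scalarSpectralMeasure_real_univ]

/-- Finite measurable partitions of the punctured disc into small cells. -/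
theorem exists_partition (K : ℝ) {δ : ℝ} (hδ : 0 < δ) :
    ∃ (n : ℕ) (c : Fin n → ℂ) (S : Fin n → Set ℂ), (∀ i, MeasurableSet (S i)) ∧
      Pairwise (Function.onFun Disjoint S) ∧ (⋃ i, S i = {z | z ≠ 0 ∧ ‖z‖ < K}) ∧
      ∀ i, ∀ z ∈ S i, dist z (c i) < δ := by
  obtain ⟨t, -, htf, ht⟩ := (isCompact_closedBall (0 : ℂ) K).finite_cover_balls hδ
  have hD : MeasurableSet {z : ℂ | z ≠ 0 ∧ ‖z‖ < K} :=
    (isOpen_ne.inter (isOpen_lt continuous_norm continuous_const)).measurableSet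
  have := htf.fintype
  let c : Fin (Fintype.card t) → ℂ := fun i => ((Fintype.equivFin t).symm i : ℂ)
  let B : Fin (Fintype.card t) → Set ℂ := fun i => Metric.ball (c i) δ ∩ {z | z ≠ 0 ∧ ‖z‖ < K}
  have hB : ∀ i, MeasurableSet (disjointed B i) := fun i => by
    rw [disjointed_apply, Finset.sup_set_eq_biUnion]
    exact (measurableSet_ball.inter hD).diff
      (Finset.measurableSet_biUnion _ fun j _ => measurableSet_ball.inter hD)
  refine ⟨_, c, disjointed B, hB, disjoint_disjointed B, ?_, fun i z hz =>
    (disjointed_subset B i hz).1⟩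
  rw [iUnion_disjointed]
  ext z
  refine ⟨fun hz => ?_, fun hz => ?_⟩
  · obtain ⟨i, hi⟩ := Set.mem_iUnion.mp hz
    exact hi.2
  · have hzK : z ∈ Metric.closedBall (0 : ℂ) K := by simpa using hz.2.le
    obtain ⟨w, hw, hzw⟩ := Set.mem_iUnion₂.mp (ht hzK)
    refine Set.mem_iUnion.mpr ⟨Fintype.equivFin t ⟨w, hw⟩, ?_, hz⟩
    simpa [c] using hzw

/-- Adapted bases of `a` and `b` can be matched up to a small displacement. -/
theorem exists_injective_matching [TopologicalSpace.SeparableSpace H] (a b : H →L[ℂ] H)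
    [IsStarNormal a] [IsStarNormal b]
    (h : ∀ Δ : Set ℂ, IsOpen Δ → Δ ⊆ {0}ᶜ →
      MurrayVonNeumannEquiv (spectralMeasure a Δ) (spectralMeasure b Δ))
    {K : ℝ} {ι A B : Type*} [Fintype ι] {S : ι → Set ℂ} (hS : ∀ i, MeasurableSet (S i))
    (hD : ⋃ i, S i = {z | z ≠ 0 ∧ ‖z‖ < K})
    {c : ι → ℂ} {δ : ℝ} (hc : ∀ i, ∀ z ∈ S i, dist z (c i) < δ)
    {cellA : A → ι} {cellB : B → ι} {e : A → H} {f : B → H}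
    (he : IsAdaptedBasis a S cellA e) (hf : IsAdaptedBasis b S cellB f) :
    ∃ φ : A → B, Function.Injective φ ∧ ∀ α, dist (c (cellA α)) (c (cellB (φ α))) < 2 * δ := by
  have := countable_of_orthonormal he.isRangeBasis.orthonormal
  refine exists_injective_of_hall cellB (fun α k => dist (c (cellA α)) (c k) < 2 * δ)
    fun s F hF => ?_
  -- `U` contains the cells of all `α ∈ s`, and a cell meeting `U` has its centre within `2 * δ` of
  -- one of theirs.
  let U : Set ℂ := {z | z ≠ 0 ∧ ‖z‖ < K} ∩ ⋃ α ∈ s, Metric.ball (c (cellA α)) δ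
  have hU : IsOpen U := (isOpen_ne.inter (isOpen_lt continuous_norm continuous_const)).inter
    (isOpen_biUnion fun _ _ => Metric.isOpen_ball)
  refine card_le_card_of_murrayVonNeumannEquiv a b hS he hf hU.measurableSet
    (by rw [hD]; exact Set.inter_subset_left) (h U hU fun z hz => hz.1.1) s F
    (fun α hα z hz => ⟨?_, Set.mem_biUnion hα (hc _ z hz)⟩) fun β hβ => ?_
  · rw [← hD]
    exact Set.mem_iUnion.mpr ⟨_, hz⟩
  · rw [Set.disjoint_left]
    intro z hzU hzS
    obtain ⟨α, hα, hzα⟩ := Set.mem_iUnion₂.mp hzU.2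
    refine hβ ((hF β).mpr ⟨α, hα, ?_⟩)
    have h1 := dist_triangle_left (c (cellA α)) (c (cellB β)) z
    have h2 := hc _ z hzS
    rw [Metric.mem_ball] at hzα
    linarith

theorem spectralMeasure_punctured_disc (a : H →L[ℂ] H) [IsStarNormal a] {K : ℝ} (hK : ‖a‖ < K) :
    spectralMeasure a {z | z ≠ 0 ∧ ‖z‖ < K} = spectralMeasure a {0}ᶜ := by
  have hD : MeasurableSet {z : ℂ | z ≠ 0 ∧ ‖z‖ < K} :=
    (isOpen_ne.inter (isOpen_lt continuous_norm continuous_const)).measurableSet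
  refine ext_diag fun x => ?_
  rw [inner_spectralMeasure a hD, inner_spectralMeasure a (measurableSet_singleton 0).compl]
  congr 1
  refine measureReal_congr ?_
  filter_upwards [ae_norm_lt a hK x] with z hz
  exact propext ⟨fun h => h.1, fun h => ⟨h, hz⟩⟩

theorem mem_closure_groupoidOrbit_of_murrayVonNeumannEquiv [TopologicalSpace.SeparableSpace H]
    (a b : H →L[ℂ] H) [IsStarNormal a] [IsStarNormal b]
    (h : ∀ Δ : Set ℂ, IsOpen Δ → Δ ⊆ {0}ᶜ →
      MurrayVonNeumannEquiv (spectralMeasure a Δ) (spectralMeasure b Δ)) :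
    b ∈ closure (groupoidOrbit a) := by
  rw [Metric.mem_closure_iff]
  intro ε hε
  obtain ⟨K, hK⟩ := exists_gt (max ‖a‖ ‖b‖)
  have hKa : ‖a‖ < K := (le_max_left _ _).trans_lt hK
  have hKb : ‖b‖ < K := (le_max_right _ _).trans_lt hK
  -- The quadratic forms will differ by at most `4 * δ` (two discretizations at `δ`, one
  -- displacement of `2 * δ`). Passing to the norm doubles this to `ε / 2`.
  set δ := ε / 16
  have hδ : 0 < δ := by positivity
  obtain ⟨n, c, S, hS, hd, hD, hc⟩ := exists_partition K hδ
  obtain ⟨A, cellA, e, he⟩ := exists_isAdaptedBasis a hS hd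
  obtain ⟨B, cellB, f, hf⟩ := exists_isAdaptedBasis b hS hd
  obtain ⟨φ, hφ, hφd⟩ := exists_injective_matching a b h hS hD hc he hf
  obtain ⟨ψ, hψ, hψd⟩ := exists_injective_matching b a (fun Δ h1 h2 => (h Δ h1 h2).symm)
    hS hD hc hf he
  -- Each pair matched by the bijection comes from `φ` or from `ψ` reversed, so the displacement
  -- bound survives.
  obtain ⟨θ, hθ, hθd⟩ := Function.Embedding.schroeder_bernstein_of_rel hφ hψ
    (fun α β => dist (c (cellA α)) (c (cellB β)) < 2 * δ) hφd
    fun β => by rw [dist_comm]; exact hψd β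
  let Θ : A ≃ B := Equiv.ofBijective θ hθ
  have hDm := MeasurableSet.iUnion hS
  have hfΘ : IsRangeBasis (spectralMeasure b (⋃ i, S i)) (f ∘ Θ) :=
    ⟨hf.isRangeBasis.orthonormal.comp Θ Θ.injective,
      fun y => Θ.hasSum_iff.mpr (hf.isRangeBasis.hasSum y)⟩
  obtain ⟨v, hv1, hv2, hvi⟩ := exists_partialIsometry
    (isStarProjection_spectralMeasure a hDm) (isStarProjection_spectralMeasure b hDm)
    he.isRangeBasis hfΘ
  refine ⟨v * a * star v, ⟨v, ?_, rfl⟩, ?_⟩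
  · rw [hv1, hD, spectralMeasure_punctured_disc a hKa, rangeProjection_eq_spectralMeasure]
  have hnorm : ‖b - v * a * star v‖ ≤ 2 * (4 * δ) := by
    refine norm_le_two_mul_of_inner_le (by positivity) fun x => ?_
    have e1 : ⟪x, (v * a * star v) x⟫_ℂ = ⟪star v x, a (star v x)⟫_ℂ := by
      rw [ContinuousLinearMap.star_eq_adjoint, ContinuousLinearMap.adjoint_inner_left]
      rfl
    have hvx : ‖star v x‖ ≤ ‖x‖ := by
      have h1 : ‖star v x‖ ^ 2 = ‖spectralMeasure b (⋃ i, S i) x‖ ^ 2 := by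
        refine Complex.ofReal_injective ?_
        rw [norm_sq_of_isStarProjection (isStarProjection_spectralMeasure b hDm), ← hv2,
          ← inner_self_eq_ofReal_norm_sq, ContinuousLinearMap.star_eq_adjoint,
          ContinuousLinearMap.adjoint_inner_left]
        rfl
      rw [sq_eq_sq₀ (norm_nonneg _) (norm_nonneg _)] at h1
      rw [h1]
      exact norm_apply_le_of_isStarProjection (isStarProjection_spectralMeasure b hDm) x
    -- By `hvi`, the coefficients of `star v x` in `e` are those of `x` in `f ∘ Θ`. The two diagonal
    -- forms thus have the same weights, and their eigenvalues differ by less than `2 * δ`.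
    have s1 := he.hasSum_weight c (star v x)
    simp only [hvi] at s1
    have s2 := Θ.hasSum_iff.mpr (hf.hasSum_weight c x)
    have s3 := (s2.sub s1).norm_le_of_bounded ((hfΘ.hasSum x).mul_right (2 * δ)) fun α => by
      simp only [Function.comp_apply]
      rw [← mul_sub, norm_mul, Complex.norm_real, Real.norm_of_nonneg (by positivity),
        ← dist_eq_norm, dist_comm]
      exact mul_le_mul_of_nonneg_left (hθd α).le (by positivity)
    have s4 : ‖spectralMeasure b (⋃ i, S i) x‖ ^ 2 ≤ ‖x‖ ^ 2 := pow_le_pow_left₀ (norm_nonneg _)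
      (norm_apply_le_of_isStarProjection (isStarProjection_spectralMeasure b hDm) x) 2
    have s5 : ‖star v x‖ ^ 2 ≤ ‖x‖ ^ 2 := pow_le_pow_left₀ (norm_nonneg _) hvx 2
    have t1 := norm_inner_sub_sum_le a hKa hS hd hD hδ.le hc (star v x)
    have t2 := norm_inner_sub_sum_le b hKb hS hd hD hδ.le hc x
    rw [sub_apply, inner_sub_right, e1]
    set p := ∑ i, (((scalarSpectralMeasure a (star v x)).real (S i) : ℝ) : ℂ) * c i
    set q := ∑ i, (((scalarSpectralMeasure b x).real (S i) : ℝ) : ℂ) * c i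
    have e2 : ⟪x, b x⟫_ℂ - ⟪star v x, a (star v x)⟫_ℂ =
        (⟪x, b x⟫_ℂ - q) + (q - p) - (⟪star v x, a (star v x)⟫_ℂ - p) := by ring
    rw [e2]
    refine (norm_sub_le _ _).trans ?_
    have n1 := norm_add_le (⟪x, b x⟫_ℂ - q) (q - p)
    have m1 := mul_le_mul_of_nonneg_right s4 (by positivity : 0 ≤ 2 * δ)
    have m2 := mul_le_mul_of_nonneg_left s5 hδ.le
    linarith
  rw [dist_eq_norm]
  refine hnorm.trans_lt ?_
  simp only [δ]
  linarith

end NormalOperator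
end

/-! ### The characterization of the orbit closure -/

theorem mainTheorem8 {H : Type*} [NormedAddCommGroup H] [InnerProductSpace ℂ H] [CompleteSpace H]
    [TopologicalSpace.SeparableSpace H] (hH : ¬ FiniteDimensional ℂ H)
    (a b : H →L[ℂ] H) [IsStarNormal a] [IsStarNormal b] :
    b ∈ closure (NormalOperator.groupoidOrbit a) ↔
      spectrum ℂ a ∪ {0} = spectrum ℂ b ∪ {0} ∧
        ∀ Δ : Set ℂ, IsOpen Δ → Δ ⊆ {0}ᶜ →
          NormalOperator.MurrayVonNeumannEquiv
            (NormalOperator.spectralMeasure a Δ) (NormalOperator.spectralMeasure b Δ) := by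
  refine ⟨fun h => ?_, fun h =>
    NormalOperator.mem_closure_groupoidOrbit_of_murrayVonNeumannEquiv a b h.2⟩
  have h' := fun (Δ : Set ℂ) (h1 : IsOpen Δ) (h2 : Δ ⊆ {0}ᶜ) =>
    NormalOperator.murrayVonNeumannEquiv_spectralMeasure_of_mem_closure a b h h1 h2
  exact ⟨Set.Subset.antisymm (NormalOperator.spectrum_subset_of_murrayVonNeumannEquiv a b h')
    (NormalOperator.spectrum_subset_of_murrayVonNeumannEquiv b a
      fun Δ h1 h2 => (h' Δ h1 h2).symm), h'⟩
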